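/- **Setting.** Let $(X_i,Y_i,\delta_i)$, $i\ge 1$, be i.i.d. copies of $(X,Y,\delta)$, where $\delta\in\{0,1\}$ indicates whether $Y$ is observed and $p=P(\delta=1)\in(0,1)$. Let $b(x)=(b_1(x),\dots,b_L(x))$ be measurable real functions, $z=(1,b(x)^{T})^{T}$, $z_i=(1,b(X_i)^T)^T$, and for fixed $\theta\in\mathbb R^q$ let $U(\theta;x,y)\in\mathbb R^q$ be a measurable estimating function. Put $N_1=\sum_{i\le N}\delta_i$, $N_0=N-N_1$, and for $\lambda=(\lambda_0,\lambda_1)\in\mathbb R^{1+L}$ put $\omega^*(x;\lambda)=1+(N_0/N_1)\exp\{\lambda_0+\lambda_1^{T}b(x)\}$. Let $\hat\lambda$ be a solution (whenever one exists) of the calibration equation $\sum_{i\le N}\delta_i\,\omega^*(X_i;\lambda)z_i=\sum_{i\le N}z_i$, and let $$\hat U_{SPS}(\theta)=\frac1N\sum_{i=1}^N\delta_i\,\omega^*(X_i;\hat\lambda)\,U(\theta;X_i,Y_i).$$ Let $f_j$ denote the conditional distribution (density) of $X$ given $\delta=j$, let $r=f_0/f_1$, and let $r^*(x)=E\{r(X)\mid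 b(X)=b(x),\delta=1\}$ be the smoothed density ratio. **Regularity conditions** (at $\lambda^*\in\mathbb R^{1+L}$): $b(X)$, $U(\theta;X,Y)$ and $\delta\exp(z^{T}\lambda^*)z$ have finite second moments; $E[\delta\exp(z^{T}\lambda)\{1+\|U(\theta;X,Y)\|\}]<\infty$ for all $\lambda$ in a neighbourhood of $\lambda^*$; the matrix $E\{\delta\exp(z^{T}\lambda^*)zz^{T}\}$ is nonsingular. **Theorem.** Under the regularity conditions the weighted least-squares equation $$\sum_{i=1}^N\delta_i\exp(z_i^{T}\lambda^*)\{U(\theta;X_i,Y_i)-z_i^{T}\beta\}z_i=0$$ has a unique solution with probability tending to one, and its solution converges in probability to some $\beta^*=\beta^*(\theta)$. For this $\beta^*$ the following hold. 1. (Expansion.) Assume that the log-linear density ratio model holds: $f_0\ll f_1$ and $\log r^*(x)=\lambda_0^*+\lambda_1^{*T}b(x)$ for $f_1$-almost every $x$. Then with probability tending to one the calibration equation has a unique solution, $\hat\lambda\to\lambda^*$ in probability, and $$\hat U_{SPS}(\theta)=\frac1N\sum_{i=1}^N\Big[z_i^{T}\beta^*+\delta_i\,\omega^*(X_i;\lambda^*)\{U(\theta;X_i,Y_i)-z_i^{T}\beta^*\}\Big]+o_p(N^{-1/2}).$$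 2. (Double robustness.) Assume that $Y$ is missing at random, $Y\perp\delta\mid X$. Suppose that either (a) the selection probability model $P(\delta=1\mid X)=[1+(1/p-1)\exp\{\lambda_0^*+\lambda_1^{*T}b(X)\}]^{-1}$ holds, or (b) the outcome regression model holds, i.e. each coordinate of $E\{U(\theta;X,Y)\mid X\}$ belongs to $\mathrm{span}\{1,b_1(X),\dots,b_L(X)\}$, and $\lambda^*$ only satisfies $\int\exp\{\lambda_0^*+\lambda_1^{*T}b\}f_1=1$ and $p\int b\,[1+\tfrac{1-p}{p}\exp\{\lambda_0^*+\lambda_1^{*T}b\}]f_1=E\{b(X)\}$ (the density ratio model need not hold). Then all conclusions of part 1 hold, the leading term of the expansion has expectation $E\{U(\theta;X,Y)\}$ for every $N\ge1$, and $\hat U_{SPS}(\theta)\to E\{U(\theta;X,Y)\}$ in probability. In case (b), moreover, $z^{T}\beta^*=E\{U(\theta;X,Y)\mid X\}$ almost surely. -/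

import Mathlib

open MeasureTheory ProbabilityTheory Filter Topology

noncomputable section

namespace SmoothedPS

variable {Ω 𝒳 𝒴 : Type*} {L q : ℕ}

/-- The vector `z = (1, b(x))`. -/
def zvec (b : 𝒳 → Fin L → ℝ) (x : 𝒳) : Fin (L + 1) → ℝ := Fin.cons 1 (b x)

/-- The log-linear function `exp (λ₀ + λ₁ᵀ b(x))`. -/
def expTilt (b : 𝒳 → Fin L → ℝ) (lam : Fin (L + 1) → ℝ) (x : 𝒳) : ℝ :=
  Real.exp (zvec b x ⬝ᵥ lam)

/-- The vector-valued linear predictor `zᵀ β`; the coefficient of `z k` is the vector `β k`. -/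
def linPred (b : 𝒳 → Fin L → ℝ) (β : Fin (L + 1) → EuclideanSpace ℝ (Fin q)) (x : 𝒳) :
    EuclideanSpace ℝ (Fin q) :=
  ∑ k, zvec b x k • β k

/-! ### Sample quantities, computed from the first `N` units -/

/-- `N₁ = ∑ δᵢ`, the number of respondents. -/
def numObs (δ : ℕ → Ω → ℝ) (N : ℕ) (ω : Ω) : ℝ := ∑ i ∈ Finset.range N, δ i ω

/-- `N₀ = N - N₁`, the number of nonrespondents. -/
def numMis (δ : ℕ → Ω → ℝ) (N : ℕ) (ω : Ω) : ℝ := (N : ℝ) - numObs δ N ω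

/-- The weight function `ω*(x; λ) = 1 + (N₀ / N₁) exp (λ₀ + λ₁ᵀ b(x))`. -/
def weight (δ : ℕ → Ω → ℝ) (b : 𝒳 → Fin L → ℝ) (N : ℕ) (ω : Ω) (lam : Fin (L + 1) → ℝ)
    (x : 𝒳) : ℝ :=
  1 + numMis δ N ω / numObs δ N ω * expTilt b lam x

/-- `lam` solves the calibration equation `∑ δᵢ ω*(xᵢ; λ) zᵢ = ∑ zᵢ`. -/
def IsCalibration (X : ℕ → Ω → 𝒳) (δ : ℕ → Ω → ℝ) (b : 𝒳 → Fin L → ℝ) (N : ℕ) (ω : Ω)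
    (lam : Fin (L + 1) → ℝ) : Prop :=
  ∑ i ∈ Finset.range N, (δ i ω * weight δ b N ω lam (X i ω)) • zvec b (X i ω) =
    ∑ i ∈ Finset.range N, zvec b (X i ω)

/-- `β` solves the exponentially weighted least-squares equation
`∑ δᵢ exp (zᵢᵀ λ) {U(xᵢ, yᵢ) - zᵢᵀ β} zᵢ = 0` (one equation for each coordinate of `zᵢ`). -/
def IsWLS (X : ℕ → Ω → 𝒳) (Y : ℕ → Ω → 𝒴) (δ : ℕ → Ω → ℝ) (b : 𝒳 → Fin L → ℝ)
    (U : 𝒳 → 𝒴 → EuclideanSpace ℝ (Fin q)) (lam : Fin (L + 1) → ℝ) (N : ℕ) (ω : Ω)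
    (β : Fin (L + 1) → EuclideanSpace ℝ (Fin q)) : Prop :=
  ∀ k, ∑ i ∈ Finset.range N,
    (δ i ω * expTilt b lam (X i ω) * zvec b (X i ω) k) •
      (U (X i ω) (Y i ω) - linPred b β (X i ω)) = 0

/-- The smoothed propensity score estimating function with weights `ω*(xᵢ; λ)`. -/
def estFun (X : ℕ → Ω → 𝒳) (Y : ℕ → Ω → 𝒴) (δ : ℕ → Ω → ℝ) (b : 𝒳 → Fin L → ℝ)
    (U : 𝒳 → 𝒴 → EuclideanSpace ℝ (Fin q)) (N : ℕ) (ω : Ω) (lam : Fin (L + 1) → ℝ) :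
    EuclideanSpace ℝ (Fin q) :=
  (N : ℝ)⁻¹ • ∑ i ∈ Finset.range N,
    (δ i ω * weight δ b N ω lam (X i ω)) • U (X i ω) (Y i ω)

/-- `N⁻¹ ∑ [zᵢᵀ β + δᵢ ω*(xᵢ; λ) {U(xᵢ, yᵢ) - zᵢᵀ β}]`. -/
def linTerm (X : ℕ → Ω → 𝒳) (Y : ℕ → Ω → 𝒴) (δ : ℕ → Ω → ℝ) (b : 𝒳 → Fin L → ℝ)
    (U : 𝒳 → 𝒴 → EuclideanSpace ℝ (Fin q)) (lam : Fin (L + 1) → ℝ)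
    (β : Fin (L + 1) → EuclideanSpace ℝ (Fin q)) (N : ℕ) (ω : Ω) :
    EuclideanSpace ℝ (Fin q) :=
  (N : ℝ)⁻¹ • ∑ i ∈ Finset.range N,
    (linPred b β (X i ω) +
      (δ i ω * weight δ b N ω lam (X i ω)) •
        (U (X i ω) (Y i ω) - linPred b β (X i ω)))

/-! ### The population -/

variable [MeasurableSpace Ω] [MeasurableSpace 𝒳] [MeasurableSpace 𝒴]

/-- The triples `(Xᵢ, Yᵢ, δᵢ)` are independent and identically distributed, `δᵢ` is binary, and
`0 < P(δ = 1) < 1`. -/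
structure IsIIDSample (P : Measure Ω) (X : ℕ → Ω → 𝒳) (Y : ℕ → Ω → 𝒴) (δ : ℕ → Ω → ℝ) :
    Prop where
  measurable_X : ∀ i, Measurable (X i)
  measurable_Y : ∀ i, Measurable (Y i)
  measurable_δ : ∀ i, Measurable (δ i)
  binary : ∀ i ω, δ i ω = 0 ∨ δ i ω = 1
  indep : iIndepFun (fun i ω => (X i ω, Y i ω, δ i ω)) P
  identDistrib : ∀ i, IdentDistrib (fun ω => (X i ω, Y i ω, δ i ω))
    (fun ω => (X 0 ω, Y 0 ω, δ 0 ω)) P P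
  prob_pos : 0 < P.real {ω | δ 0 ω = 1}
  prob_lt_one : P.real {ω | δ 0 ω = 1} < 1

/-- The conditional distribution of `X` given `δ = j`. -/
def condLaw (P : Measure Ω) (X : ℕ → Ω → 𝒳) (δ : ℕ → Ω → ℝ) (j : ℝ) : Measure 𝒳 :=
  (P[|{ω | δ 0 ω = j}]).map (X 0)

/-- The density ratio `r(x) = f₀(x) / f₁(x)` of the conditional distributions of `X`. -/
def densityRatio (P : Measure Ω) (X : ℕ → Ω → 𝒳) (δ : ℕ → Ω → ℝ) (x : 𝒳) : ℝ :=
  ((condLaw P X δ 0).rnDeriv (condLaw P X δ 1) x).toReal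

/-- The smoothed density ratio `r*(x) = E{r(X) | b(X) = b(x), δ = 1}`. -/
def smoothedDensityRatio (P : Measure Ω) (X : ℕ → Ω → 𝒳) (δ : ℕ → Ω → ℝ)
    (b : 𝒳 → Fin L → ℝ) : 𝒳 → ℝ :=
  (condLaw P X δ 1)[densityRatio P X δ | MeasurableSpace.comap b inferInstance]

/-- The log-linear density ratio model `log r*(x) = λ₀ + λ₁ᵀ b(x)`, where the distribution of `X`
given `δ = 0` is absolutely continuous with respect to that given `δ = 1`. -/
structure LogLinearModel (P : Measure Ω) (X : ℕ → Ω → 𝒳) (δ : ℕ → Ω → ℝ)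
    (b : 𝒳 → Fin L → ℝ) (lam : Fin (L + 1) → ℝ) : Prop where
  absCont : condLaw P X δ 0 ≪ condLaw P X δ 1
  ratio_eq : smoothedDensityRatio P X δ b =ᵐ[condLaw P X δ 1] expTilt b lam

/-- `exp (λ₀ + λ₁ᵀ b(x)) f₁(x)` is the exponential tilting of `f₁` that is normalized and
satisfies the moment constraint
`p ∫ b(x) [1 + ((1 - p) / p) exp (λ₀ + λ₁ᵀ b(x))] f₁(x) dx = E{b(X)}`, `p = P(δ = 1)`. No relation
between this tilting and the true density ratio is assumed. -/
structure IsProjection (P : Measure Ω) (X : ℕ → Ω → 𝒳) (δ : ℕ → Ω → ℝ)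
    (b : 𝒳 → Fin L → ℝ) (lam : Fin (L + 1) → ℝ) : Prop where
  normalized : ∫ x, expTilt b lam x ∂(condLaw P X δ 1) = 1
  moment : ∀ l, P.real {ω | δ 0 ω = 1} *
      ∫ x, b x l * (1 + (1 - P.real {ω | δ 0 ω = 1}) / P.real {ω | δ 0 ω = 1} *
        expTilt b lam x) ∂(condLaw P X δ 1) = ∫ ω, b (X 0 ω) l ∂P

/-- Missing at random, `Y ⟂ δ | X`, for the binary variable `δ`:
`P(δ = 1 | X, Y) = P(δ = 1 | X)`. -/
def MissingAtRandom (P : Measure Ω) (X : ℕ → Ω → 𝒳) (Y : ℕ → Ω → 𝒴) (δ : ℕ → Ω → ℝ) : Prop :=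
  P[δ 0 | MeasurableSpace.comap (fun ω => (X 0 ω, Y 0 ω)) inferInstance]
    =ᵐ[P] P[δ 0 | MeasurableSpace.comap (X 0) inferInstance]

/-- The selection probability model
`P(δ = 1 | x) = 1 / [1 + (1 / p - 1) exp (λ₀ + λ₁ᵀ b(x))]`, `p = P(δ = 1)`. -/
def SelectionModel (P : Measure Ω) (X : ℕ → Ω → 𝒳) (δ : ℕ → Ω → ℝ)
    (b : 𝒳 → Fin L → ℝ) (lam : Fin (L + 1) → ℝ) : Prop :=
  P[δ 0 | MeasurableSpace.comap (X 0) inferInstance] =ᵐ[P]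
    fun ω => 1 / (1 + (1 / P.real {ω | δ 0 ω = 1} - 1) * expTilt b lam (X 0 ω))

/-- The outcome regression function `E{U(X, Y) | X}`. -/
def outcomeMean (P : Measure Ω) (X : ℕ → Ω → 𝒳) (Y : ℕ → Ω → 𝒴)
    (U : 𝒳 → 𝒴 → EuclideanSpace ℝ (Fin q)) : Ω → EuclideanSpace ℝ (Fin q) :=
  P[fun ω => U (X 0 ω) (Y 0 ω) | MeasurableSpace.comap (X 0) inferInstance]

/-- The outcome regression model: every coordinate of `E{U(X, Y) | x}` is in the span of
`1, b₁(x), …, b_L(x)`. -/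
def OutcomeModel (P : Measure Ω) (X : ℕ → Ω → 𝒳) (Y : ℕ → Ω → 𝒴) (b : 𝒳 → Fin L → ℝ)
    (U : 𝒳 → 𝒴 → EuclideanSpace ℝ (Fin q)) : Prop :=
  ∃ α : Fin (L + 1) → EuclideanSpace ℝ (Fin q),
    outcomeMean P X Y U =ᵐ[P] fun ω => linPred b α (X 0 ω)

/-- The regularity conditions: measurability, second moments, local integrability of the
exponential tilting, and nonsingularity of the matrix `E{δ exp (zᵀ λ) z zᵀ}`. -/
structure Regularity (P : Measure Ω) (X : ℕ → Ω → 𝒳) (Y : ℕ → Ω → 𝒴) (δ : ℕ → Ω → ℝ)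
    (b : 𝒳 → Fin L → ℝ) (U : 𝒳 → 𝒴 → EuclideanSpace ℝ (Fin q)) (lam : Fin (L + 1) → ℝ) :
    Prop where
  measurable_b : Measurable b
  measurable_U : Measurable (Function.uncurry U)
  moment_b : MemLp (fun ω => b (X 0 ω)) 2 P
  moment_U : MemLp (fun ω => U (X 0 ω) (Y 0 ω)) 2 P
  moment_tilt : MemLp (fun ω => (δ 0 ω * expTilt b lam (X 0 ω)) • zvec b (X 0 ω)) 2 P
  local_integrable : ∀ᶠ l in 𝓝 lam,
    Integrable (fun ω => δ 0 ω * expTilt b l (X 0 ω) * (1 + ‖U (X 0 ω) (Y 0 ω)‖)) P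
  nonsingular : (Matrix.of fun j k : Fin (L + 1) =>
    ∫ ω, δ 0 ω * expTilt b lam (X 0 ω) * zvec b (X 0 ω) j * zvec b (X 0 ω) k ∂P).det ≠ 0

/-- The asymptotic linear expansion. With probability tending to one the calibration equation has
exactly one solution; and whenever `lamHat N` is a solution of it on the event that there is one,
`lamHat N → lam` in probability and
`√N (Û_SPS - N⁻¹ ∑ [zᵢᵀ β + δᵢ ω*(xᵢ; λ) {U(xᵢ, yᵢ) - zᵢᵀ β}]) → 0` in probability. -/
def Expansion (P : Measure Ω) (X : ℕ → Ω → 𝒳) (Y : ℕ → Ω → 𝒴) (δ : ℕ → Ω → ℝ)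
    (b : 𝒳 → Fin L → ℝ) (U : 𝒳 → 𝒴 → EuclideanSpace ℝ (Fin q)) (lam : Fin (L + 1) → ℝ)
    (β : Fin (L + 1) → EuclideanSpace ℝ (Fin q)) : Prop :=
  Tendsto (fun N => P {ω | ¬ ∃! l, IsCalibration X δ b N ω l}) atTop (𝓝 0) ∧
  ∀ lamHat : ℕ → Ω → Fin (L + 1) → ℝ,
    (∀ N ω, (∃ l, IsCalibration X δ b N ω l) → IsCalibration X δ b N ω (lamHat N ω)) →
    TendstoInMeasure P lamHat atTop (fun _ => lam) ∧
    TendstoInMeasure P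
      (fun (N : ℕ) ω => √(N : ℝ) •
        (estFun X Y δ b U N ω (lamHat N ω) - linTerm X Y δ b U lam β N ω))
      atTop (fun _ => 0)

/-- `β` is the probability limit of the solution of the exponentially weighted least-squares
equation, which exists and is unique with probability tending to one. -/
def IsWLSLimit (P : Measure Ω) (X : ℕ → Ω → 𝒳) (Y : ℕ → Ω → 𝒴) (δ : ℕ → Ω → ℝ)
    (b : 𝒳 → Fin L → ℝ) (U : 𝒳 → 𝒴 → EuclideanSpace ℝ (Fin q)) (lam : Fin (L + 1) → ℝ)
    (β : Fin (L + 1) → EuclideanSpace ℝ (Fin q)) : Prop :=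
  Tendsto (fun N => P {ω | ¬ ∃! β', IsWLS X Y δ b U lam N ω β'}) atTop (𝓝 0) ∧
  ∀ betaHat : ℕ → Ω → Fin (L + 1) → EuclideanSpace ℝ (Fin q),
    (∀ N ω, (∃ β', IsWLS X Y δ b U lam N ω β') → IsWLS X Y δ b U lam N ω (betaHat N ω)) →
    TendstoInMeasure P betaHat atTop (fun _ => β)

/-- The leading term of the expansion has expectation `E{U(X, Y)}` for every sample size `N ≥ 1`,
and the estimating function with calibrated weights converges in probability to `E{U(X, Y)}`. -/
def IsUnbiased (P : Measure Ω) (X : ℕ → Ω → 𝒳) (Y : ℕ → Ω → 𝒴) (δ : ℕ → Ω → ℝ)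
    (b : 𝒳 → Fin L → ℝ) (U : 𝒳 → 𝒴 → EuclideanSpace ℝ (Fin q)) (lam : Fin (L + 1) → ℝ)
    (β : Fin (L + 1) → EuclideanSpace ℝ (Fin q)) : Prop :=
  (∀ N : ℕ, 1 ≤ N → Integrable (linTerm X Y δ b U lam β N) P ∧
    ∫ ω, linTerm X Y δ b U lam β N ω ∂P = ∫ ω, U (X 0 ω) (Y 0 ω) ∂P) ∧
  ∀ lamHat : ℕ → Ω → Fin (L + 1) → ℝ,
    (∀ N ω, (∃ l, IsCalibration X δ b N ω l) → IsCalibration X δ b N ω (lamHat N ω)) →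
    TendstoInMeasure P (fun (N : ℕ) ω => estFun X Y δ b U N ω (lamHat N ω)) atTop
      (fun _ => ∫ ω, U (X 0 ω) (Y 0 ω) ∂P)

end SmoothedPS

end

/-!
The statement reduces to one population identity, `Balanced`: with `p = P(δ = 1)`,
`((1 - p) / p) E{δ exp(zᵀ λ*) z} = E{(1 - δ) z}`, i.e. `λ*` solves the population calibration
equation. The log-linear density ratio model gives it because the smoothed ratio has the same
`f₁`-integrals against functions of `b` as the ratio itself; the selection model gives it by
conditioning on `X`; the two moment conditions of the projection are this identity written
under `f₁`.

Given `Balanced`, the calibration equation is the critical point equation of a convex function of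
`λ`. Near `λ*` this function is bounded below by a quadratic form, the sample Gram matrix, minus a
cubic term, so it has a minimizer within a multiple of its gradient at `λ*`, and the gradient is
strictly monotone on the whole space, so there is no other critical point
(`exists_tiltScore_eq_zero`, `tiltScore_injOn_zero`). The gradient at `λ*` is `O_p(N^{-1/2})` by
Chebyshev's inequality (`boundedInProb_calScore_zero`), hence so is `λ̂ - λ*`.

Because `λ̂` is calibrated, `U` may be replaced by the residual `U - zᵀ β*` in the estimating
function, and the expansion error is `N₀/N₁` times the mean of
`δ exp(zᵀ λ*) (exp(zᵀ (λ̂ - λ*)) - 1) (U - zᵀ β*)` (`estFun_sub_linTerm`). Its part linear in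
`λ̂ - λ*` has a coefficient that tends to zero by the normal equations defining `β*` (`popBeta`),
and its remainder is quadratic, with a factor that the local integrability of the tilting controls
(`envelope`). Both are `o_p(1)` times `λ̂ - λ*` (`expansion_of_balanced`).

For unbiasedness, the odds `N₀/N₁` multiply a function of a respondent with mean zero. On the event
that unit `i` responds the odds are a function of the other units, so independence makes that part
of the leading term vanish exactly (`integral_missOdds_smul`). There remains
`E{zᵀ β* + δ (U - zᵀ β*)}`, which equals `E U` if `δ` can be dropped in front of the residual: under
the selection model by inverse propensity weighting, under the outcome model because the residual
has conditional mean zero given `X`, which also identifies `zᵀ β*` as `E{U | X}`.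
-/

namespace SmoothedPS

/-! ### Convergence and boundedness in probability -/

section InProbability

variable {Ω : Type*} [MeasurableSpace Ω] {P : Measure Ω}

/-- The filter of sets of pairs `(N, ω)` that hold with probability tending to one as `N → ∞`.
Convergence in probability of a sequence to a constant is convergence along this filter, so the
continuous mapping theorem and the Slutsky-type rules are the usual rules for limits. The (outer)
measure of the exceptional set is used, so nothing has to be measurable. -/
def inProb (P : Measure Ω) : Filter (ℕ × Ω) where
  sets := {S | Tendsto (fun N => P {ω | (N, ω) ∉ S}) atTop (𝓝 0)}
  univ_sets := by simp
  sets_of_superset := by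
    intro S T hS hST
    exact tendsto_of_tendsto_of_tendsto_of_le_of_le tendsto_const_nhds hS (fun _ => zero_le)
      (fun N => measure_mono fun ω hω h => hω (hST h))
  inter_sets := by
    intro S T hS hT
    have h : Tendsto (fun N => P {ω | (N, ω) ∉ S} + P {ω | (N, ω) ∉ T}) atTop (𝓝 0) := by
      simpa using Tendsto.add hS hT
    refine tendsto_of_tendsto_of_tendsto_of_le_of_le tendsto_const_nhds h (fun _ => zero_le)
      (fun N => (measure_mono ?_).trans (measure_union_le _ _))
    intro ω hω
    simp only [Set.mem_ofPred_eq, Set.mem_inter_iff, Set.mem_union] at hω ⊢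
    tauto

theorem eventually_inProb {p : ℕ × Ω → Prop} :
    (∀ᶠ x in inProb P, p x) ↔ Tendsto (fun N => P {ω | ¬ p (N, ω)}) atTop (𝓝 0) := Iff.rfl

theorem tendsto_fst_inProb : Tendsto Prod.fst (inProb P) (atTop : Filter ℕ) := by
  intro S hS
  change Tendsto (fun N => P {ω | (N, ω) ∉ Prod.fst ⁻¹' S}) atTop (𝓝 0)
  refine tendsto_const_nhds.congr' ?_
  filter_upwards [hS] with N hN
  simp [hN]

theorem tendstoInMeasure_const_iff {E : Type*} [PseudoEMetricSpace E] {f : ℕ → Ω → E} {c : E} :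
    TendstoInMeasure P f atTop (fun _ => c) ↔
      Tendsto (fun x : ℕ × Ω => f x.1 x.2) (inProb P) (𝓝 c) := by
  rw [EMetric.tendsto_nhds]
  simp only [eventually_inProb, not_lt]
  rfl

/-- `T` is bounded in probability, `T = O_p(1)`, in the form in which this is used: the product of
`T` with anything that tends to zero in probability tends to zero in probability. -/
def BoundedInProb (P : Measure Ω) (T : ℕ × Ω → ℝ) : Prop :=
  ∀ a : ℕ × Ω → ℝ, Tendsto a (inProb P) (𝓝 0) → Tendsto (fun x => a x * T x) (inProb P) (𝓝 0)

theorem BoundedInProb.add {S T : ℕ × Ω → ℝ} (hS : BoundedInProb P S) (hT : BoundedInProb P T) :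
    BoundedInProb P (fun x => S x + T x) := by
  intro a ha
  simpa [mul_add] using (hS a ha).add (hT a ha)

theorem BoundedInProb.sum {ι : Type*} (s : Finset ι) {T : ι → ℕ × Ω → ℝ}
    (hT : ∀ i ∈ s, BoundedInProb P (T i)) : BoundedInProb P (fun x => ∑ i ∈ s, T i x) := by
  intro a ha
  simp_rw [Finset.mul_sum]
  simpa using tendsto_finsetSum s fun i hi => hT i hi a ha

theorem BoundedInProb.tendsto_mul {S T : ℕ × Ω → ℝ} {c : ℝ} (hS : Tendsto S (inProb P) (𝓝 c))
    (hT : BoundedInProb P T) : BoundedInProb P (fun x => S x * T x) := by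
  intro a ha
  have h := hT (fun x => a x * S x) (by simpa using ha.mul hS)
  simpa [mul_assoc] using h

theorem BoundedInProb.congr' {S T : ℕ × Ω → ℝ} (hT : BoundedInProb P T)
    (h : ∀ᶠ x in inProb P, S x = T x) : BoundedInProb P S := by
  intro a ha
  refine (hT a ha).congr' ?_
  filter_upwards [h] with x hx
  rw [hx]

theorem BoundedInProb.abs {T : ℕ × Ω → ℝ} (hT : BoundedInProb P T) :
    BoundedInProb P (fun x => |T x|) := by
  intro a ha
  rw [tendsto_zero_iff_abs_tendsto_zero]
  have h := (hT a ha).abs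
  simpa [Function.comp_def, abs_mul] using h

theorem BoundedInProb.mono {S T : ℕ × Ω → ℝ} (hT : BoundedInProb P T)
    (h : ∀ᶠ x in inProb P, |S x| ≤ |T x|) : BoundedInProb P S := by
  intro a ha
  refine squeeze_zero_norm' ?_ (by simpa using (hT a ha).abs)
  filter_upwards [h] with x hx
  rw [Real.norm_eq_abs, abs_mul]
  gcongr

/-- A uniform Chebyshev tail bound implies boundedness in probability. -/
theorem BoundedInProb.of_tail {T : ℕ × Ω → ℝ} {C : ℝ}
    (h : ∀ (N : ℕ) (c : ℝ), 0 < c → P {ω | c ≤ |T (N, ω)|} ≤ ENNReal.ofReal (C / c ^ 2)) :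
    BoundedInProb P T := by
  intro a ha
  rw [Metric.tendsto_nhds] at ha ⊢
  intro ε hε
  rw [eventually_inProb, ENNReal.tendsto_nhds_zero]
  intro η hη
  have hlim : Tendsto (fun c : ℝ => ENNReal.ofReal (C / c ^ 2)) atTop (𝓝 0) := by
    have : Tendsto (fun c : ℝ => C / c ^ 2) atTop (𝓝 0) :=
      tendsto_const_nhds.div_atTop (tendsto_pow_atTop two_ne_zero)
    simpa using ENNReal.tendsto_ofReal this
  have hη2 : 0 < η / 2 := ENNReal.half_pos hη.ne'
  obtain ⟨c, hc, hc0⟩ :=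
    ((ENNReal.tendsto_nhds_zero.1 hlim (η / 2) hη2).and (eventually_gt_atTop 0)).exists
  have ha' := eventually_inProb.1 (ha (ε / c) (by positivity))
  filter_upwards [ENNReal.tendsto_nhds_zero.1 ha' (η / 2) hη2] with N hN
  calc P {ω | ¬ dist (a (N, ω) * T (N, ω)) 0 < ε}
      ≤ P ({ω | c ≤ |T (N, ω)|} ∪ {ω | ¬ dist (a (N, ω)) 0 < ε / c}) := by
        refine measure_mono fun ω hω => ?_
        by_contra hcon
        simp only [Set.mem_union, Set.mem_ofPred_eq, not_or, not_le, not_not, dist_zero_right,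
          Real.norm_eq_abs] at hcon
        refine hω ?_
        rw [dist_zero_right, Real.norm_eq_abs, abs_mul]
        calc |a (N, ω)| * |T (N, ω)| ≤ |a (N, ω)| * c := by gcongr; exact hcon.1.le
          _ < ε / c * c := by gcongr; exact hcon.2
          _ = ε := by field_simp
    _ ≤ η / 2 + η / 2 := (measure_union_le _ _).trans (add_le_add ((h N c hc0).trans hc) hN)
    _ = η := ENNReal.add_halves η

end InProbability

/-! ### Sample means of independent identically distributed data -/

section SampleMean

variable {Ω S : Type*} [MeasurableSpace Ω] [MeasurableSpace S] {P : Measure Ω}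
  {W : ℕ → Ω → S}

/-- The mean of `h (W 0), …, h (W (N - 1))`, as a function of the pair `(N, ω)`. -/
noncomputable def sampleMean {E : Type*} [AddCommGroup E] [Module ℝ E] (W : ℕ → Ω → S) (h : S → E)
    (x : ℕ × Ω) : E :=
  (x.1 : ℝ)⁻¹ • ∑ i ∈ Finset.range x.1, h (W i x.2)

/-- The weak law of large numbers. -/
theorem tendsto_sampleMean [IsProbabilityMeasure P] {E : Type*} [NormedAddCommGroup E]
    [NormedSpace ℝ E] [CompleteSpace E] [MeasurableSpace E] [BorelSpace E]
    (hW : iIndepFun W P) (hid : ∀ i, IdentDistrib (W i) (W 0) P P) {h : S → E}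
    (hh : Measurable h) (hint : Integrable (fun ω => h (W 0 ω)) P) :
    Tendsto (sampleMean W h) (inProb P) (𝓝 (∫ ω, h (W 0 ω) ∂P)) := by
  have hid' : ∀ i, IdentDistrib (fun ω => h (W i ω)) (fun ω => h (W 0 ω)) P P :=
    fun i => (hid i).comp hh
  have hae := strong_law_ae (μ := P) (fun i ω => h (W i ω)) hint
    (fun i j hij => (hW.indepFun hij).comp hh hh) hid'
  have hint' : ∀ i, Integrable (fun ω => h (W i ω)) P := fun i => (hid' i).integrable_iff.2 hint
  have hm : ∀ N : ℕ, AEStronglyMeasurable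
      (fun ω => (N : ℝ)⁻¹ • ∑ i ∈ Finset.range N, h (W i ω)) P := fun N =>
    ((integrable_finsetSum _ fun i _ => hint' i).smul (N : ℝ)⁻¹).aestronglyMeasurable
  have hconv : TendstoInMeasure P (fun N ω => sampleMean W h (N, ω)) atTop
      (fun _ => ∫ ω, h (W 0 ω) ∂P) := tendstoInMeasure_of_tendsto_ae hm hae
  rw [tendstoInMeasure_const_iff] at hconv
  exact hconv

/-- The fluctuations of a sample mean of square-integrable variables are of order `N^{-1/2}`. -/
theorem boundedInProb_sampleMean [IsProbabilityMeasure P]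
    (hW : iIndepFun W P) (hid : ∀ i, IdentDistrib (W i) (W 0) P P) {h : S → ℝ}
    (hh : Measurable h) (hL2 : MemLp (fun ω => h (W 0 ω)) 2 P) :
    BoundedInProb P
      (fun x => √(x.1 : ℝ) * (sampleMean W h x - ∫ ω, h (W 0 ω) ∂P)) := by
  have hid' : ∀ i, IdentDistrib (fun ω => h (W i ω)) (fun ω => h (W 0 ω)) P P :=
    fun i => (hid i).comp hh
  have hL2' : ∀ i, MemLp (fun ω => h (W i ω)) 2 P := fun i => (hid' i).memLp_iff.2 hL2
  refine BoundedInProb.of_tail (C := variance (fun ω => h (W 0 ω)) P) fun N c hc => ?_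
  rcases Nat.eq_zero_or_pos N with rfl | hN
  · simp [hc.not_ge]
  have hN' : (0 : ℝ) < N := by exact_mod_cast hN
  set V : Ω → ℝ := fun ω => ∑ i ∈ Finset.range N, h (W i ω) with hV
  have hVL : MemLp V 2 P := memLp_finsetSum _ fun i _ => hL2' i
  have hEV : ∫ ω, V ω ∂P = N * ∫ ω, h (W 0 ω) ∂P := by
    rw [hV, integral_finsetSum _ fun i _ => (hL2' i).integrable (by norm_num)]
    simp [(hid' _).integral_eq]
  have hvar : variance V P = N * variance (fun ω => h (W 0 ω)) P := by
    have : V = ∑ i ∈ Finset.range N, fun ω => h (W i ω) := by ext ω; simp [hV]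
    rw [this, IndepFun.variance_sum (fun i _ => hL2' i)
      (fun i _ j _ hij => (hW.indepFun hij).comp hh hh)]
    simp [(hid' _).variance_eq]
  have hs : 0 < √(N : ℝ) := Real.sqrt_pos.2 hN'
  have hch := meas_ge_le_variance_div_sq hVL (c := c * √(N : ℝ)) (by positivity)
  rw [hvar, hEV, mul_pow, Real.sq_sqrt hN'.le] at hch
  refine (measure_mono fun ω hω => ?_).trans (hch.trans_eq ?_)
  · simp only [Set.mem_ofPred_eq, sampleMean] at hω ⊢
    have e : V ω - N * ∫ ω, h (W 0 ω) ∂P = √(N : ℝ) * (√(N : ℝ) * ((N : ℝ)⁻¹ • (V ω) -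
        ∫ ω, h (W 0 ω) ∂P)) := by
      rw [← mul_assoc, Real.mul_self_sqrt hN'.le, smul_eq_mul]
      field_simp
    rw [e, abs_mul, abs_of_pos hs, mul_comm c]
    gcongr
  · congr 1
    field_simp

end SampleMean

/-! ### The equation `∑ aᵢ exp(zᵢ ⬝ d) zᵢ = v` -/

section ExponentialEquation

theorem quarter_sq_sub_cube_le_exp (t : ℝ) :
    t ^ 2 / 4 - |t| ^ 3 / 8 ≤ Real.exp t - 1 - t := by
  -- square `1 + t / 2 ≤ exp (t / 2)` where the left side is nonnegative; otherwise `|t| ≥ 2` and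
  -- the left side of the claim is not positive
  rcases le_total 0 (1 + t / 2) with h | h
  · have h1 : (1 + t / 2) ^ 2 ≤ Real.exp t := by
      have h2 : 1 + t / 2 ≤ Real.exp (t / 2) := by linarith [Real.add_one_le_exp (t / 2)]
      calc (1 + t / 2) ^ 2 ≤ Real.exp (t / 2) ^ 2 := by gcongr
        _ = Real.exp t := by rw [← Real.exp_nat_mul]; congr 1; push_cast; ring
    have : 0 ≤ |t| ^ 3 := by positivity
    nlinarith
  · have h1 : 2 ≤ |t| := by rw [abs_of_neg (by linarith)]; linarith
    have h2 : t ^ 2 / 4 ≤ |t| ^ 3 / 8 := by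
      rw [← sq_abs]; nlinarith [sq_nonneg |t|]
    linarith [Real.add_one_le_exp t]

theorem exp_sub_le_mul (t : ℝ) : Real.exp t - 1 - t ≤ (Real.exp t - 1) * t := by
  have h := Real.add_one_le_exp (-t)
  have h2 : Real.exp t * Real.exp (-t) = 1 := by rw [← Real.exp_add]; simp
  nlinarith [Real.exp_pos t]

theorem abs_exp_sub_one_sub_le (t : ℝ) : |Real.exp t - 1 - t| ≤ t ^ 2 * Real.exp |t| := by
  have h0 : 0 ≤ Real.exp t - 1 - t := by linarith [Real.add_one_le_exp t]
  rw [abs_of_nonneg h0]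
  have h1 : (Real.exp t - 1) * t ≤ t ^ 2 * Real.exp |t| := by
    have h3 : Real.exp t * Real.exp (-t) = 1 := by rw [← Real.exp_add]; simp
    rcases le_total 0 t with h | h
    · rw [abs_of_nonneg h]
      have h2 := Real.add_one_le_exp (-t)
      have : Real.exp t - 1 ≤ t * Real.exp t := by nlinarith [Real.exp_pos t]
      nlinarith
    · rw [abs_of_nonpos h]
      have h2 := Real.add_one_le_exp t
      have h4 : 1 ≤ Real.exp (-t) := Real.one_le_exp (by linarith)
      have : (Real.exp t - 1) * t ≤ t * t := by nlinarith
      nlinarith [mul_self_nonneg t]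
  exact (exp_sub_le_mul t).trans h1

theorem abs_dotProduct_le {κ : Type*} [Fintype κ] (u v : κ → ℝ) :
    |u ⬝ᵥ v| ≤ Fintype.card κ * ‖u‖ * ‖v‖ := by
  calc |u ⬝ᵥ v| ≤ ∑ k, |u k * v k| := Finset.abs_sum_le_sum_abs _ _
    _ ≤ ∑ _k : κ, ‖u‖ * ‖v‖ := by
        gcongr with k
        rw [abs_mul]
        exact mul_le_mul (norm_le_pi_norm u k) (norm_le_pi_norm v k) (abs_nonneg _) (norm_nonneg _)
    _ = Fintype.card κ * ‖u‖ * ‖v‖ := by simp [mul_assoc]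

variable {ι κ : Type*} [Fintype κ] (s : Finset ι) (a : ι → ℝ) (z : ι → κ → ℝ) (v : κ → ℝ)

/-- The convex function whose critical points solve `∑ aᵢ exp(zᵢ ⬝ d) zᵢ = v`. -/
noncomputable def tiltPotential (d : κ → ℝ) : ℝ :=
  ∑ i ∈ s, a i * Real.exp (z i ⬝ᵥ d) - v ⬝ᵥ d

/-- The gradient of `tiltPotential`. -/
noncomputable def tiltScore (d : κ → ℝ) : κ → ℝ :=
  ∑ i ∈ s, (a i * Real.exp (z i ⬝ᵥ d)) • z i - v

variable {s a z v}

theorem tiltScore_dotProduct (d u : κ → ℝ) :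
    tiltScore s a z v d ⬝ᵥ u = ∑ i ∈ s, a i * Real.exp (z i ⬝ᵥ d) * (z i ⬝ᵥ u) - v ⬝ᵥ u := by
  simp [tiltScore, sub_dotProduct, sum_dotProduct, smul_dotProduct]

theorem tiltScore_eq_zero_of_isLocalMin {d : κ → ℝ}
    (h : IsLocalMin (tiltPotential s a z v) d) : tiltScore s a z v d = 0 := by
  classical
  refine dotProduct_eq_zero _ fun u => ?_
  have hline : Continuous fun t : ℝ => d + t • u := by fun_prop
  have hmin : IsLocalMin (fun t : ℝ => tiltPotential s a z v (d + t • u)) 0 := by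
    have h' : IsLocalMin (tiltPotential s a z v) (d + (0 : ℝ) • u) := by simpa using h
    exact IsLocalMin.comp_continuous (g := fun t : ℝ => d + t • u) (b := 0) h'
      hline.continuousAt
  have hder : HasDerivAt (fun t : ℝ => tiltPotential s a z v (d + t • u))
      (tiltScore s a z v d ⬝ᵥ u) 0 := by
    rw [tiltScore_dotProduct]
    simp only [tiltPotential, dotProduct_add, dotProduct_smul, smul_eq_mul]
    refine HasDerivAt.sub (HasDerivAt.fun_sum fun i _ => ?_) ?_
    · have h1 : HasDerivAt (fun t : ℝ => z i ⬝ᵥ d + t * (z i ⬝ᵥ u)) (z i ⬝ᵥ u) 0 := by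
        simpa using ((hasDerivAt_id (0 : ℝ)).mul_const (z i ⬝ᵥ u)).const_add (z i ⬝ᵥ d)
      simpa [mul_assoc] using (h1.exp.const_mul (a i))
    · simpa using ((hasDerivAt_id (0 : ℝ)).mul_const (v ⬝ᵥ u)).const_add (v ⬝ᵥ d)
  exact hmin.hasDerivAt_eq_zero hder

/-- Strict monotonicity of the score: when the weighted second-moment form of the `zᵢ` is positive
definite, the score has at most one zero. -/
theorem tiltScore_injOn_zero {c : ℝ} (hc : 0 < c) (ha : ∀ i ∈ s, 0 ≤ a i)
    (hQ : ∀ d : κ → ℝ, c * ‖d‖ ^ 2 ≤ ∑ i ∈ s, a i * (z i ⬝ᵥ d) ^ 2) {d e : κ → ℝ}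
    (hd : tiltScore s a z v d = 0) (he : tiltScore s a z v e = 0) : d = e := by
  have hpos : ∀ x y : ℝ, 0 ≤ (Real.exp x - Real.exp y) * (x - y) := fun x y => by
    rcases le_total x y with h | h
    · exact mul_nonneg_of_nonpos_of_nonpos (by simpa using h) (by simpa using h)
    · exact mul_nonneg (by simpa using h) (by simpa using h)
  have hsum : ∑ i ∈ s, a i * ((Real.exp (z i ⬝ᵥ d) - Real.exp (z i ⬝ᵥ e)) *
      (z i ⬝ᵥ d - z i ⬝ᵥ e)) = 0 := by
    have h1 := tiltScore_dotProduct (s := s) (a := a) (z := z) (v := v) d (d - e)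
    have h2 := tiltScore_dotProduct (s := s) (a := a) (z := z) (v := v) e (d - e)
    rw [hd, zero_dotProduct] at h1
    rw [he, zero_dotProduct] at h2
    have h3 : ∑ i ∈ s, a i * Real.exp (z i ⬝ᵥ d) * (z i ⬝ᵥ (d - e)) -
        ∑ i ∈ s, a i * Real.exp (z i ⬝ᵥ e) * (z i ⬝ᵥ (d - e)) = 0 := by linarith
    rw [← h3, ← Finset.sum_sub_distrib]
    refine Finset.sum_congr rfl fun i _ => ?_
    rw [dotProduct_sub]; ring
  have hzero := (Finset.sum_eq_zero_iff_of_nonneg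
    fun i hi => mul_nonneg (ha i hi) (hpos _ _)).1 hsum
  have hform : ∑ i ∈ s, a i * (z i ⬝ᵥ (d - e)) ^ 2 = 0 := by
    refine Finset.sum_eq_zero fun i hi => ?_
    rcases mul_eq_zero.1 (hzero i hi) with h | h
    · simp [h]
    · have : z i ⬝ᵥ d = z i ⬝ᵥ e := by
        rcases mul_eq_zero.1 h with h | h
        · exact Real.exp_injective (sub_eq_zero.1 h)
        · exact sub_eq_zero.1 h
      simp [dotProduct_sub, this]
  have h := hQ (d - e)
  rw [hform] at h
  have h0 : ‖d - e‖ ^ 2 ≤ 0 := by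
    by_contra hcon
    push Not at hcon
    nlinarith
  have : ‖d - e‖ = 0 := by nlinarith [norm_nonneg (d - e)]
  exact sub_eq_zero.1 (norm_eq_zero.1 this)

/-- Near the origin the quadratic part dominates the cubic remainder. -/
theorem quadratic_le_tilt_remainder {c T r : ℝ} (ha : ∀ i ∈ s, 0 ≤ a i)
    (hQ : ∀ d : κ → ℝ, c * ‖d‖ ^ 2 ≤ ∑ i ∈ s, a i * (z i ⬝ᵥ d) ^ 2)
    (hT : ∑ i ∈ s, a i * ‖z i‖ ^ 3 ≤ T) (hr : (Fintype.card κ : ℝ) ^ 3 * T * r ≤ c)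
    (hT0 : 0 ≤ T) {d : κ → ℝ} (hd : ‖d‖ ≤ r) :
    c / 8 * ‖d‖ ^ 2 ≤ ∑ i ∈ s, a i * (Real.exp (z i ⬝ᵥ d) - 1 - z i ⬝ᵥ d) := by
  set n : ℝ := (Fintype.card κ : ℝ) with hn
  have hcube : ∑ i ∈ s, a i * |z i ⬝ᵥ d| ^ 3 ≤ c * ‖d‖ ^ 2 := by
    calc ∑ i ∈ s, a i * |z i ⬝ᵥ d| ^ 3 ≤ ∑ i ∈ s, a i * (n * ‖z i‖ * ‖d‖) ^ 3 := by
          gcongr with i hi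
          · exact ha i hi
          · exact abs_dotProduct_le _ _
      _ = n ^ 3 * (∑ i ∈ s, a i * ‖z i‖ ^ 3) * ‖d‖ * ‖d‖ ^ 2 := by
          rw [Finset.mul_sum, Finset.sum_mul, Finset.sum_mul]
          exact Finset.sum_congr rfl fun i _ => by ring
      _ ≤ n ^ 3 * T * r * ‖d‖ ^ 2 := by gcongr
      _ ≤ c * ‖d‖ ^ 2 := by gcongr
  calc c / 8 * ‖d‖ ^ 2 ≤ (∑ i ∈ s, a i * (z i ⬝ᵥ d) ^ 2) / 4 -
        (∑ i ∈ s, a i * |z i ⬝ᵥ d| ^ 3) / 8 := by linarith [hQ d]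
    _ = ∑ i ∈ s, a i * ((z i ⬝ᵥ d) ^ 2 / 4 - |z i ⬝ᵥ d| ^ 3 / 8) := by
        rw [Finset.sum_div, Finset.sum_div, ← Finset.sum_sub_distrib]
        exact Finset.sum_congr rfl fun i _ => by ring
    _ ≤ _ := by
        exact Finset.sum_le_sum fun i hi =>
          mul_le_mul_of_nonneg_left (quarter_sq_sub_cube_le_exp _) (ha i hi)

/-- Solvability of `∑ aᵢ exp(zᵢ ⬝ d) zᵢ = v` when the score `∑ aᵢ zᵢ - v` at the origin is small:
a solution exists in the ball of radius `r`, and it is bounded by a multiple of the score at the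
origin. -/
theorem exists_tiltScore_eq_zero {c T r : ℝ} (hr0 : 0 < r)
    (ha : ∀ i ∈ s, 0 ≤ a i)
    (hQ : ∀ d : κ → ℝ, c * ‖d‖ ^ 2 ≤ ∑ i ∈ s, a i * (z i ⬝ᵥ d) ^ 2)
    (hT : ∑ i ∈ s, a i * ‖z i‖ ^ 3 ≤ T) (hr : (Fintype.card κ : ℝ) ^ 3 * T * r ≤ c)
    (hT0 : 0 ≤ T) (hg : Fintype.card κ * ‖tiltScore s a z v 0‖ < c / 8 * r) :
    ∃ d, ‖d‖ ≤ r ∧ c / 8 * ‖d‖ ≤ Fintype.card κ * ‖tiltScore s a z v 0‖ ∧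
      tiltScore s a z v d = 0 := by
  set g := tiltScore s a z v 0 with hgdef
  have hgd : ∀ u, g ⬝ᵥ u = ∑ i ∈ s, a i * (z i ⬝ᵥ u) - v ⬝ᵥ u := fun u => by
    rw [hgdef, tiltScore_dotProduct]; simp
  have hcont : Continuous (tiltPotential s a z v) := by
    unfold tiltPotential dotProduct
    fun_prop
  obtain ⟨d, hdmem, hdmin⟩ := (isCompact_closedBall (0 : κ → ℝ) r).exists_isMinOn
    ⟨0, by simp [hr0.le]⟩ hcont.continuousOn
  have hd : ‖d‖ ≤ r := by simpa using hdmem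
  have hrem := quadratic_le_tilt_remainder ha hQ hT hr hT0 hd
  have hdot := abs_dotProduct_le g d
  -- on the sphere of radius `r` the potential exceeds its value at the origin
  have hlt : ‖d‖ < r := by
    refine lt_of_le_of_ne hd fun heq => ?_
    have h0 : tiltPotential s a z v d ≤ tiltPotential s a z v 0 :=
      hdmin (by simp [hr0.le] : (0 : κ → ℝ) ∈ Metric.closedBall 0 r)
    have hdiff : tiltPotential s a z v d - tiltPotential s a z v 0 =
        g ⬝ᵥ d + ∑ i ∈ s, a i * (Real.exp (z i ⬝ᵥ d) - 1 - z i ⬝ᵥ d) := by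
      rw [hgd]
      simp only [tiltPotential, dotProduct_zero, Real.exp_zero, mul_sub, Finset.sum_sub_distrib]
      ring
    rw [heq] at hrem hdot
    nlinarith [neg_abs_le (g ⬝ᵥ d)]
  have hloc : IsLocalMin (tiltPotential s a z v) d :=
    hdmin.isLocalMin (Metric.closedBall_mem_nhds_of_mem (by simpa using hlt))
  have hz := tiltScore_eq_zero_of_isLocalMin hloc
  refine ⟨d, hd, ?_, hz⟩
  have h1 := tiltScore_dotProduct (s := s) (a := a) (z := z) (v := v) d d
  rw [hz, zero_dotProduct] at h1
  have h2 : ∑ i ∈ s, a i * (Real.exp (z i ⬝ᵥ d) - 1 - z i ⬝ᵥ d) ≤ -(g ⬝ᵥ d) := by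
    calc _ ≤ ∑ i ∈ s, a i * ((Real.exp (z i ⬝ᵥ d) - 1) * (z i ⬝ᵥ d)) := by
          gcongr with i hi
          · exact ha i hi
          · exact exp_sub_le_mul _
      _ = -(g ⬝ᵥ d) := by
          rw [hgd]
          have : ∑ i ∈ s, a i * ((Real.exp (z i ⬝ᵥ d) - 1) * (z i ⬝ᵥ d)) =
              ∑ i ∈ s, a i * Real.exp (z i ⬝ᵥ d) * (z i ⬝ᵥ d) - ∑ i ∈ s, a i * (z i ⬝ᵥ d) := by
            rw [← Finset.sum_sub_distrib]
            exact Finset.sum_congr rfl fun i _ => by ring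
          linarith
  rcases (norm_nonneg d).eq_or_lt with h0 | h0
  · rw [← h0]; simp; positivity
  · have h3 : c / 8 * ‖d‖ * ‖d‖ ≤ Fintype.card κ * ‖g‖ * ‖d‖ := by
      nlinarith [neg_abs_le (g ⬝ᵥ d)]
    exact le_of_mul_le_mul_right h3 h0

end ExponentialEquation

/-! ### Linear systems with vector unknowns and quadratic forms -/

section MatrixAction

variable {κ E : Type*} [Fintype κ]

/-- The action `(A β)ⱼ = ∑ₖ Aⱼₖ βₖ` of a real matrix on a family of vectors. -/
def matAct [AddCommGroup E] [Module ℝ E] (A : Matrix κ κ ℝ) (β : κ → E) (j : κ) : E :=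
  ∑ k, A j k • β k

theorem matAct_mul [AddCommGroup E] [Module ℝ E] (A B : Matrix κ κ ℝ) (β : κ → E) :
    matAct (A * B) β = matAct A (matAct B β) := by
  ext j
  simp only [matAct, Matrix.mul_apply, Finset.sum_smul, Finset.smul_sum, mul_smul]
  exact Finset.sum_comm

theorem matAct_one [DecidableEq κ] [AddCommGroup E] [Module ℝ E] (β : κ → E) :
    matAct (1 : Matrix κ κ ℝ) β = β := by
  ext j
  simp [matAct, Matrix.one_apply]

theorem matAct_eq_iff [DecidableEq κ] [AddCommGroup E] [Module ℝ E] {A : Matrix κ κ ℝ}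
    (hA : A.det ≠ 0) {β c : κ → E} : matAct A β = c ↔ β = matAct A⁻¹ c := by
  have hu : IsUnit A.det := isUnit_iff_ne_zero.2 hA
  constructor
  · rintro rfl
    rw [← matAct_mul, Matrix.nonsing_inv_mul A hu, matAct_one]
  · rintro rfl
    rw [← matAct_mul, Matrix.mul_nonsing_inv A hu, matAct_one]

theorem tendsto_matAct_inv [DecidableEq κ] [NormedAddCommGroup E] [NormedSpace ℝ E] {α : Type*}
    {l : Filter α} {A : α → Matrix κ κ ℝ} {c : α → κ → E} {A₀ : Matrix κ κ ℝ} {c₀ : κ → E}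
    (h0 : A₀.det ≠ 0) (hA : Tendsto A l (𝓝 A₀)) (hc : Tendsto c l (𝓝 c₀)) :
    Tendsto (fun x => matAct (A x)⁻¹ (c x)) l (𝓝 (matAct A₀⁻¹ c₀)) := by
  have hdet : Tendsto (fun x => (A x).det) l (𝓝 A₀.det) :=
    ((continuous_id.matrix_det).tendsto A₀).comp hA
  have hadj : Tendsto (fun x => (A x).adjugate) l (𝓝 A₀.adjugate) :=
    ((continuous_id.matrix_adjugate).tendsto A₀).comp hA
  have hinv : Tendsto (fun x => (A x)⁻¹) l (𝓝 A₀⁻¹) := by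
    simp only [Matrix.inv_def, Ring.inverse_eq_inv']
    exact (hdet.inv₀ h0).smul hadj
  rw [tendsto_pi_nhds]
  intro j
  refine tendsto_finsetSum _ fun k _ => ?_
  exact ((tendsto_pi_nhds.1 ((tendsto_pi_nhds.1 hinv) j)) k).smul (tendsto_pi_nhds.1 hc k)

/-- A positive definite quadratic form is bounded below by a multiple of the squared norm, with the
same multiple for all nearby matrices. -/
theorem eventually_quadratic_form_ge {M : Matrix κ κ ℝ} (hM : M.PosDef) :
    ∃ c, 0 < c ∧ ∀ᶠ A in 𝓝 M, ∀ d : κ → ℝ, c * ‖d‖ ^ 2 ≤ d ⬝ᵥ A.mulVec d := by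
  have hcont : Continuous fun d : κ → ℝ => d ⬝ᵥ M.mulVec d := by fun_prop
  obtain ⟨c, hc, hlow⟩ : ∃ c, 0 < c ∧ ∀ d : κ → ℝ, ‖d‖ = 1 → c ≤ d ⬝ᵥ M.mulVec d := by
    rcases (Metric.sphere (0 : κ → ℝ) 1).eq_empty_or_nonempty with he | hne
    · refine ⟨1, one_pos, fun d hd => ?_⟩
      have : d ∈ Metric.sphere (0 : κ → ℝ) 1 := by simpa using hd
      simp [he] at this
    · obtain ⟨d₀, hd₀, hmin⟩ := (isCompact_sphere (0 : κ → ℝ) 1).exists_isMinOn hne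
        hcont.continuousOn
      refine ⟨d₀ ⬝ᵥ M.mulVec d₀, ?_, fun d hd => hmin (by simpa using hd)⟩
      have h0 : d₀ ≠ 0 := by
        rintro rfl
        simp at hd₀
      simpa using hM.dotProduct_mulVec_pos h0
  have hlow' : ∀ d : κ → ℝ, c * ‖d‖ ^ 2 ≤ d ⬝ᵥ M.mulVec d := fun d => by
    rcases eq_or_ne d 0 with rfl | hd
    · simp
    have hn : 0 < ‖d‖ := norm_pos_iff.2 hd
    have h := hlow (‖d‖⁻¹ • d) (by rw [norm_smul, norm_inv, norm_norm, inv_mul_cancel₀ hn.ne'])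
    rw [Matrix.mulVec_smul, dotProduct_smul, smul_dotProduct, smul_eq_mul, smul_eq_mul] at h
    calc c * ‖d‖ ^ 2 ≤ ‖d‖⁻¹ * (‖d‖⁻¹ * (d ⬝ᵥ M.mulVec d)) * ‖d‖ ^ 2 := by gcongr
      _ = d ⬝ᵥ M.mulVec d := by field_simp
  refine ⟨c / 2, half_pos hc, ?_⟩
  have hclose : Tendsto (fun A : Matrix κ κ ℝ => ∑ j, ∑ k, |A j k - M j k|) (𝓝 M) (𝓝 0) := by
    have : Continuous fun A : Matrix κ κ ℝ => ∑ j, ∑ k, |A j k - M j k| := by fun_prop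
    simpa using this.tendsto M
  filter_upwards [hclose.eventually_lt_const (half_pos hc)] with A hA d
  have hdiff : |d ⬝ᵥ A.mulVec d - d ⬝ᵥ M.mulVec d| ≤ c / 2 * ‖d‖ ^ 2 := by
    rw [← dotProduct_sub, ← Matrix.sub_mulVec]
    calc |d ⬝ᵥ (A - M).mulVec d| = |∑ j, ∑ k, d j * ((A j k - M j k) * d k)| := by
          simp [dotProduct, Matrix.mulVec, Finset.mul_sum]
      _ ≤ ∑ j, ∑ k, |d j * ((A j k - M j k) * d k)| :=
          (Finset.abs_sum_le_sum_abs _ _).trans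
            (Finset.sum_le_sum fun j _ => Finset.abs_sum_le_sum_abs _ _)
      _ ≤ ∑ j, ∑ k, |A j k - M j k| * ‖d‖ ^ 2 := by
          refine Finset.sum_le_sum fun j _ => Finset.sum_le_sum fun k _ => ?_
          rw [abs_mul, abs_mul]
          have hj : |d j| ≤ ‖d‖ := norm_le_pi_norm d j
          have hk : |d k| ≤ ‖d‖ := norm_le_pi_norm d k
          calc |d j| * (|A j k - M j k| * |d k|) ≤ ‖d‖ * (|A j k - M j k| * ‖d‖) := by gcongr
            _ = |A j k - M j k| * ‖d‖ ^ 2 := by ring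
      _ = (∑ j, ∑ k, |A j k - M j k|) * ‖d‖ ^ 2 := by simp [Finset.sum_mul]
      _ ≤ c / 2 * ‖d‖ ^ 2 := by gcongr
  have := (abs_le.1 hdiff).1
  linarith [hlow' d]

end MatrixAction

/-! ### The regressors `z` and the exponential tilting -/

section Regressors

variable {𝒳 : Type*} {L q : ℕ} {b : 𝒳 → Fin L → ℝ}

@[simp]
theorem zvec_zero (b : 𝒳 → Fin L → ℝ) (x : 𝒳) : zvec b x 0 = 1 := rfl

@[simp]
theorem zvec_succ (b : 𝒳 → Fin L → ℝ) (x : 𝒳) (l : Fin L) : zvec b x l.succ = b x l := rfl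

theorem one_le_norm_zvec (b : 𝒳 → Fin L → ℝ) (x : 𝒳) : 1 ≤ ‖zvec b x‖ := by
  simpa using norm_le_pi_norm (zvec b x) 0

theorem expTilt_pos (b : 𝒳 → Fin L → ℝ) (lam : Fin (L + 1) → ℝ) (x : 𝒳) :
    0 < expTilt b lam x := Real.exp_pos _

theorem expTilt_eq_mul (b : 𝒳 → Fin L → ℝ) (lam l : Fin (L + 1) → ℝ) (x : 𝒳) :
    expTilt b l x = expTilt b lam x * Real.exp (zvec b x ⬝ᵥ (l - lam)) := by
  rw [expTilt, expTilt, ← Real.exp_add, dotProduct_sub]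
  congr 1; ring

theorem norm_linPred_le (b : 𝒳 → Fin L → ℝ) (β : Fin (L + 1) → EuclideanSpace ℝ (Fin q)) (x : 𝒳) :
    ‖linPred b β x‖ ≤ (∑ k, ‖β k‖) * ‖zvec b x‖ := by
  rw [linPred, Finset.sum_mul]
  refine (norm_sum_le _ _).trans (Finset.sum_le_sum fun k _ => ?_)
  rw [norm_smul, mul_comm]
  gcongr
  exact norm_le_pi_norm (zvec b x) k

variable [MeasurableSpace 𝒳]

theorem measurable_zvec_apply (hb : Measurable b) (k : Fin (L + 1)) :
    Measurable fun x => zvec b x k := by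
  refine Fin.cases ?_ (fun l => ?_) k
  · simp
  · exact (measurable_pi_apply l).comp hb

theorem measurable_zvec (hb : Measurable b) : Measurable (zvec b) :=
  measurable_pi_iff.2 (measurable_zvec_apply hb)

theorem measurable_expTilt (hb : Measurable b) (lam : Fin (L + 1) → ℝ) :
    Measurable (expTilt b lam) := by
  unfold expTilt dotProduct
  exact Real.measurable_exp.comp (Finset.measurable_sum _ fun k _ =>
    (measurable_zvec_apply hb k).mul_const _)

theorem measurable_linPred (hb : Measurable b)
    (β : Fin (L + 1) → EuclideanSpace ℝ (Fin q)) : Measurable (linPred b β) := by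
  unfold linPred
  exact Finset.measurable_sum _ fun k _ => (measurable_zvec_apply hb k).smul_const _

end Regressors

/-! ### Integrability of the population moments -/

section Moments

variable {Ω 𝒳 𝒴 : Type*} {L q : ℕ}

/-- The observed data of unit `i`. -/
def obs (X : ℕ → Ω → 𝒳) (Y : ℕ → Ω → 𝒴) (δ : ℕ → Ω → ℝ) (i : ℕ) (ω : Ω) : 𝒳 × 𝒴 × ℝ :=
  (X i ω, Y i ω, δ i ω)

/-- `δ exp(zᵀ λ) zₖ`. -/
noncomputable def tiltedZ (b : 𝒳 → Fin L → ℝ) (lam : Fin (L + 1) → ℝ) (k : Fin (L + 1))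
    (w : 𝒳 × 𝒴 × ℝ) : ℝ :=
  w.2.2 * expTilt b lam w.1 * zvec b w.1 k

/-- `(1 - δ) zₖ`. -/
noncomputable def missingZ (b : 𝒳 → Fin L → ℝ) (k : Fin (L + 1)) (w : 𝒳 × 𝒴 × ℝ) : ℝ :=
  (1 - w.2.2) * zvec b w.1 k

/-- `δ exp(zᵀ λ) zⱼ zₖ`. -/
noncomputable def tiltedZZ (b : 𝒳 → Fin L → ℝ) (lam : Fin (L + 1) → ℝ) (j k : Fin (L + 1))
    (w : 𝒳 × 𝒴 × ℝ) : ℝ :=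
  tiltedZ b lam j w * zvec b w.1 k

/-- `δ exp(zᵀ λ) zₖ U`. -/
noncomputable def tiltedZU (b : 𝒳 → Fin L → ℝ) (U : 𝒳 → 𝒴 → EuclideanSpace ℝ (Fin q))
    (lam : Fin (L + 1) → ℝ) (k : Fin (L + 1)) (w : 𝒳 × 𝒴 × ℝ) : EuclideanSpace ℝ (Fin q) :=
  tiltedZ b lam k w • U w.1 w.2.1

/-- The residual `U - zᵀ β`. -/
noncomputable def resid (b : 𝒳 → Fin L → ℝ) (U : 𝒳 → 𝒴 → EuclideanSpace ℝ (Fin q))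
    (β : Fin (L + 1) → EuclideanSpace ℝ (Fin q)) (w : 𝒳 × 𝒴 × ℝ) : EuclideanSpace ℝ (Fin q) :=
  U w.1 w.2.1 - linPred b β w.1

/-- `δ exp(zᵀ λ) exp(ρ ‖z‖) (1 + ‖U‖)`, which dominates all Taylor remainders. -/
noncomputable def envelope (b : 𝒳 → Fin L → ℝ) (U : 𝒳 → 𝒴 → EuclideanSpace ℝ (Fin q))
    (lam : Fin (L + 1) → ℝ) (ρ : ℝ) (w : 𝒳 × 𝒴 × ℝ) : ℝ :=
  w.2.2 * expTilt b lam w.1 * (Real.exp (ρ * ‖zvec b w.1‖) * (1 + ‖U w.1 w.2.1‖))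

theorem tiltedZ_smul_resid (b : 𝒳 → Fin L → ℝ) (U : 𝒳 → 𝒴 → EuclideanSpace ℝ (Fin q))
    (lam : Fin (L + 1) → ℝ) (β : Fin (L + 1) → EuclideanSpace ℝ (Fin q)) (k : Fin (L + 1))
    (w : 𝒳 × 𝒴 × ℝ) : tiltedZ b lam k w • resid b U β w =
      tiltedZU b U lam k w - ∑ j, tiltedZZ b lam k j w • β j := by
  simp only [resid, tiltedZU, tiltedZZ, linPred, smul_sub, Finset.smul_sum, mul_smul]

variable [MeasurableSpace Ω] [MeasurableSpace 𝒳] [MeasurableSpace 𝒴]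
  {P : Measure Ω} {X : ℕ → Ω → 𝒳} {Y : ℕ → Ω → 𝒴} {δ : ℕ → Ω → ℝ}
  {b : 𝒳 → Fin L → ℝ} {U : 𝒳 → 𝒴 → EuclideanSpace ℝ (Fin q)} {lam : Fin (L + 1) → ℝ}

theorem IsIIDSample.measurable_obs (hs : IsIIDSample P X Y δ) (i : ℕ) :
    Measurable (obs X Y δ i) :=
  (hs.measurable_X i).prodMk ((hs.measurable_Y i).prodMk (hs.measurable_δ i))

theorem IsIIDSample.iIndepFun_obs (hs : IsIIDSample P X Y δ) : iIndepFun (obs X Y δ) P :=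
  hs.indep

theorem IsIIDSample.identDistrib_obs (hs : IsIIDSample P X Y δ) (i : ℕ) :
    IdentDistrib (obs X Y δ i) (obs X Y δ 0) P P :=
  hs.identDistrib i

theorem IsIIDSample.nonneg (hs : IsIIDSample P X Y δ) (i : ℕ) (ω : Ω) : 0 ≤ δ i ω := by
  rcases hs.binary i ω with h | h <;> simp [h]

theorem IsIIDSample.abs_le_one (hs : IsIIDSample P X Y δ) (i : ℕ) (ω : Ω) : ‖δ i ω‖ ≤ 1 := by
  rcases hs.binary i ω with h | h <;> simp [h]

theorem measurable_tiltedZ (hb : Measurable b) (k : Fin (L + 1)) :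
    Measurable (tiltedZ b lam k : 𝒳 × 𝒴 × ℝ → ℝ) :=
  (measurable_snd.snd.mul ((measurable_expTilt hb lam).comp measurable_fst)).mul
    ((measurable_zvec_apply hb k).comp measurable_fst)

theorem measurable_missingZ (hb : Measurable b) (k : Fin (L + 1)) :
    Measurable (missingZ b k : 𝒳 × 𝒴 × ℝ → ℝ) :=
  (measurable_const.sub measurable_snd.snd).mul
    ((measurable_zvec_apply hb k).comp measurable_fst)

theorem measurable_tiltedZZ (hb : Measurable b) (j k : Fin (L + 1)) :
    Measurable (tiltedZZ b lam j k : 𝒳 × 𝒴 × ℝ → ℝ) :=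
  (measurable_tiltedZ hb j).mul ((measurable_zvec_apply hb k).comp measurable_fst)

theorem measurable_U_obs (hU : Measurable (Function.uncurry U)) :
    Measurable fun w : 𝒳 × 𝒴 × ℝ => U w.1 w.2.1 :=
  hU.comp (measurable_fst.prodMk measurable_snd.fst)

theorem measurable_tiltedZU (hb : Measurable b) (hU : Measurable (Function.uncurry U))
    (k : Fin (L + 1)) : Measurable (tiltedZU b U lam k) :=
  (measurable_tiltedZ hb k).smul (measurable_U_obs hU)

theorem measurable_resid (hb : Measurable b) (hU : Measurable (Function.uncurry U))
    (β : Fin (L + 1) → EuclideanSpace ℝ (Fin q)) : Measurable (resid b U β) :=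
  (measurable_U_obs hU).sub ((measurable_linPred hb β).comp measurable_fst)

theorem measurable_envelope (hb : Measurable b) (hU : Measurable (Function.uncurry U)) (ρ : ℝ) :
    Measurable (envelope b U lam ρ) :=
  (measurable_snd.snd.mul ((measurable_expTilt hb lam).comp measurable_fst)).mul
    ((Real.measurable_exp.comp
      (measurable_const.mul ((measurable_zvec hb).comp measurable_fst).norm)).mul
        (measurable_const.add (measurable_U_obs hU).norm))

section
variable (hs : IsIIDSample P X Y δ) (hr : Regularity P X Y δ b U lam)
include hs

theorem integrable_delta [IsProbabilityMeasure P] (i : ℕ) : Integrable (δ i) P :=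
  Integrable.of_bound (hs.measurable_δ i).aestronglyMeasurable 1
    (ae_of_all _ (hs.abs_le_one i))

theorem integral_delta : ∫ ω, δ 0 ω ∂P = P.real {ω | δ 0 ω = 1} := by
  have h : δ 0 = Set.indicator {ω | δ 0 ω = 1} (fun _ => (1 : ℝ)) := by
    ext ω
    rcases hs.binary 0 ω with h | h <;> simp [h]
  have hm : MeasurableSet {ω | δ 0 ω = 1} := hs.measurable_δ 0 (measurableSet_singleton 1)
  conv_lhs => rw [h]
  rw [integral_indicator hm]
  simp

omit hs
include hr

theorem memLp_tiltedZ (k : Fin (L + 1)) :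
    MemLp (fun ω => tiltedZ b lam k (obs X Y δ 0 ω)) 2 P :=
  hr.moment_tilt.eval k

theorem memLp_zvec [IsProbabilityMeasure P] (k : Fin (L + 1)) :
    MemLp (fun ω => zvec b (X 0 ω) k) 2 P := by
  refine Fin.cases ?_ (fun l => ?_) k
  · simpa using memLp_const (1 : ℝ)
  · simpa using hr.moment_b.eval l

theorem integrable_tiltedZZ [IsProbabilityMeasure P] (j k : Fin (L + 1)) :
    Integrable (fun ω => tiltedZZ b lam j k (obs X Y δ 0 ω)) P :=
  (memLp_tiltedZ hr j).integrable_mul (memLp_zvec hr k)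

theorem integrable_tiltedZU (k : Fin (L + 1)) :
    Integrable (fun ω => tiltedZU b U lam k (obs X Y δ 0 ω)) P := by
  have h : MemLp (fun ω => tiltedZU b U lam k (obs X Y δ 0 ω)) 1 P :=
    hr.moment_U.smul (memLp_tiltedZ hr k)
  exact memLp_one_iff_integrable.1 h

theorem integrable_U [IsProbabilityMeasure P] : Integrable (fun ω => U (X 0 ω) (Y 0 ω)) P :=
  hr.moment_U.integrable (by norm_num)

theorem integrable_linPred [IsProbabilityMeasure P]
    (β : Fin (L + 1) → EuclideanSpace ℝ (Fin q)) :
    Integrable (fun ω => linPred b β (X 0 ω)) P := by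
  unfold linPred
  exact integrable_finsetSum _ fun k _ =>
    ((memLp_zvec hr k).integrable (by norm_num)).smul_const (β k)

theorem integrable_resid [IsProbabilityMeasure P]
    (β : Fin (L + 1) → EuclideanSpace ℝ (Fin q)) :
    Integrable (fun ω => resid b U β (obs X Y δ 0 ω)) P :=
  (integrable_U hr).sub (integrable_linPred hr β)

theorem integrable_tiltedZ_smul_resid [IsProbabilityMeasure P]
    (β : Fin (L + 1) → EuclideanSpace ℝ (Fin q)) (k : Fin (L + 1)) :
    Integrable (fun ω => tiltedZ b lam k (obs X Y δ 0 ω) • resid b U β (obs X Y δ 0 ω)) P := by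
  simp_rw [tiltedZ_smul_resid]
  exact (integrable_tiltedZU hr k).sub (integrable_finsetSum _ fun j _ =>
    (integrable_tiltedZZ hr k j).smul_const (β j))

include hs

theorem memLp_missingZ [IsProbabilityMeasure P] (k : Fin (L + 1)) :
    MemLp (fun ω => missingZ b k (obs X Y δ 0 ω)) 2 P := by
  refine (memLp_zvec hr k).mono
    ((measurable_missingZ hr.measurable_b k).comp (hs.measurable_obs 0)).aestronglyMeasurable
    (ae_of_all _ fun ω => ?_)
  have h : ‖1 - δ 0 ω‖ ≤ 1 := by rcases hs.binary 0 ω with h | h <;> simp [h]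
  simp only [missingZ, obs, norm_mul]
  exact mul_le_of_le_one_left (norm_nonneg _) h

/-- A small exponential moment in every direction `± eₖ` gives one for the sup norm. -/
theorem exists_integrable_envelope :
    ∃ ρ, 0 < ρ ∧ Integrable (fun ω => envelope b U lam ρ (obs X Y δ 0 ω)) P := by
  obtain ⟨ε, hε, hball⟩ := Metric.eventually_nhds_iff.1 hr.local_integrable
  refine ⟨ε / 2, half_pos hε, ?_⟩
  set ρ := ε / 2 with hρ
  have hint : ∀ (k : Fin (L + 1)) (t : ℝ), |t| = ρ → Integrable (fun ω => δ 0 ω *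
      expTilt b (lam + Pi.single k t) (X 0 ω) * (1 + ‖U (X 0 ω) (Y 0 ω)‖)) P := by
    intro k t ht
    refine hball ?_
    rw [dist_eq_norm, add_sub_cancel_left, Pi.norm_single, Real.norm_eq_abs, ht, hρ]
    linarith
  refine (integrable_finsetSum Finset.univ fun k _ => (hint k ρ (abs_of_pos (half_pos hε))).add
    (hint k (-ρ) (by rw [abs_neg, abs_of_pos (half_pos hε)]))).mono'
    ((measurable_envelope hr.measurable_b hr.measurable_U ρ).comp
      (hs.measurable_obs 0)).aestronglyMeasurable (ae_of_all _ fun ω => ?_)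
  have hexp : ∀ (k : Fin (L + 1)) (t : ℝ), expTilt b (lam + Pi.single k t) (X 0 ω) =
      expTilt b lam (X 0 ω) * Real.exp (t * zvec b (X 0 ω) k) := fun k t => by
    rw [expTilt_eq_mul b lam, add_sub_cancel_left, dotProduct_single, mul_comm t]
  obtain ⟨k₀, -, hk₀⟩ := Finset.exists_max_image Finset.univ
    (fun k => ‖zvec b (X 0 ω) k‖) Finset.univ_nonempty
  have hnorm : ‖zvec b (X 0 ω)‖ ≤ |zvec b (X 0 ω) k₀| :=
    (pi_norm_le_iff_of_nonneg (abs_nonneg _)).2 fun k => hk₀ k (Finset.mem_univ k)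
  have hle : Real.exp (ρ * ‖zvec b (X 0 ω)‖) ≤
      ∑ k, (Real.exp (ρ * zvec b (X 0 ω) k) + Real.exp (-ρ * zvec b (X 0 ω) k)) := by
    refine le_trans ?_ (Finset.single_le_sum (f := fun k => Real.exp (ρ * zvec b (X 0 ω) k) +
      Real.exp (-ρ * zvec b (X 0 ω) k)) (fun k _ => by positivity) (Finset.mem_univ k₀))
    refine (Real.exp_le_exp.2 (mul_le_mul_of_nonneg_left hnorm (half_pos hε).le)).trans ?_
    rcases abs_cases (zvec b (X 0 ω) k₀) with ⟨h, -⟩ | ⟨h, -⟩ <;> rw [h]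
    · linarith [Real.exp_pos (-ρ * zvec b (X 0 ω) k₀)]
    · rw [mul_neg, ← neg_mul]
      linarith [Real.exp_pos (ρ * zvec b (X 0 ω) k₀)]
  have hw : 0 ≤ δ 0 ω * expTilt b lam (X 0 ω) :=
    mul_nonneg (hs.nonneg 0 ω) (expTilt_pos _ _ _).le
  have henv : 0 ≤ envelope b U lam ρ (obs X Y δ 0 ω) := mul_nonneg hw (by positivity)
  rw [Real.norm_of_nonneg henv]
  calc envelope b U lam ρ (obs X Y δ 0 ω)
      ≤ δ 0 ω * expTilt b lam (X 0 ω) *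
        ((∑ k, (Real.exp (ρ * zvec b (X 0 ω) k) + Real.exp (-ρ * zvec b (X 0 ω) k))) *
          (1 + ‖U (X 0 ω) (Y 0 ω)‖)) := by
        simp only [envelope, obs]
        gcongr
    _ = _ := by
        rw [Finset.sum_mul, Finset.mul_sum]
        refine Finset.sum_congr rfl fun k _ => ?_
        simp only [Pi.add_apply, hexp]
        ring

end
end Moments

/-! ### The weighted least-squares equation -/

section WeightedLeastSquares

variable {Ω 𝒳 𝒴 : Type*} {L q : ℕ}

/-- The sample Gram matrix `N⁻¹ ∑ δᵢ exp(zᵢᵀ λ) zᵢ zᵢᵀ`. -/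
noncomputable def sampleGram (X : ℕ → Ω → 𝒳) (Y : ℕ → Ω → 𝒴) (δ : ℕ → Ω → ℝ)
    (b : 𝒳 → Fin L → ℝ) (lam : Fin (L + 1) → ℝ) (x : ℕ × Ω) :
    Matrix (Fin (L + 1)) (Fin (L + 1)) ℝ :=
  Matrix.of fun j k => sampleMean (obs X Y δ) (tiltedZZ b lam j k) x

/-- For `N ≥ 1` the least-squares equation is a linear system with matrix `sampleGram`. -/
theorem isWLS_iff {X : ℕ → Ω → 𝒳} {Y : ℕ → Ω → 𝒴} {δ : ℕ → Ω → ℝ} {b : 𝒳 → Fin L → ℝ}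
    {U : 𝒳 → 𝒴 → EuclideanSpace ℝ (Fin q)} {lam : Fin (L + 1) → ℝ} {N : ℕ} (hN : 0 < N) {ω : Ω}
    {β : Fin (L + 1) → EuclideanSpace ℝ (Fin q)} :
    IsWLS X Y δ b U lam N ω β ↔ matAct (sampleGram X Y δ b lam (N, ω)) β =
      fun k => sampleMean (obs X Y δ) (tiltedZU b U lam k) (N, ω) := by
  have hN' : ((N : ℝ)⁻¹) ≠ 0 := inv_ne_zero (by exact_mod_cast hN.ne')
  rw [funext_iff, IsWLS]
  refine forall_congr' fun k => ?_
  have h1 : matAct (sampleGram X Y δ b lam (N, ω)) β k =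
      (N : ℝ)⁻¹ • ∑ i ∈ Finset.range N, ∑ j, tiltedZZ b lam k j (obs X Y δ i ω) • β j := by
    simp only [matAct, sampleGram, sampleMean, Matrix.of_apply, smul_eq_mul, mul_smul,
      Finset.sum_smul, Finset.smul_sum]
    exact Finset.sum_comm
  have h2 : ∑ i ∈ Finset.range N, (δ i ω * expTilt b lam (X i ω) * zvec b (X i ω) k) •
      (U (X i ω) (Y i ω) - linPred b β (X i ω)) =
      ∑ i ∈ Finset.range N, tiltedZU b U lam k (obs X Y δ i ω) -
      ∑ i ∈ Finset.range N, ∑ j, tiltedZZ b lam k j (obs X Y δ i ω) • β j := by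
    rw [← Finset.sum_sub_distrib]
    exact Finset.sum_congr rfl fun i _ => tiltedZ_smul_resid b U lam β k (obs X Y δ i ω)
  rw [h1, h2, sub_eq_zero, eq_comm, sampleMean, (smul_right_injective _ hN').eq_iff]

variable [MeasurableSpace Ω] [MeasurableSpace 𝒳] [MeasurableSpace 𝒴]

/-- The population Gram matrix `E{δ exp(zᵀ λ) z zᵀ}`. -/
noncomputable def gram (P : Measure Ω) (X : ℕ → Ω → 𝒳) (Y : ℕ → Ω → 𝒴) (δ : ℕ → Ω → ℝ)
    (b : 𝒳 → Fin L → ℝ) (lam : Fin (L + 1) → ℝ) : Matrix (Fin (L + 1)) (Fin (L + 1)) ℝ :=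
  Matrix.of fun j k => ∫ ω, tiltedZZ b lam j k (obs X Y δ 0 ω) ∂P

/-- The solution of the population normal equations
`E[δ exp(zᵀ λ) z {U - zᵀ β}] = 0`. -/
noncomputable def popBeta (P : Measure Ω) (X : ℕ → Ω → 𝒳) (Y : ℕ → Ω → 𝒴) (δ : ℕ → Ω → ℝ)
    (b : 𝒳 → Fin L → ℝ) (U : 𝒳 → 𝒴 → EuclideanSpace ℝ (Fin q)) (lam : Fin (L + 1) → ℝ) :
    Fin (L + 1) → EuclideanSpace ℝ (Fin q) :=
  matAct (gram P X Y δ b lam)⁻¹ fun k => ∫ ω, tiltedZU b U lam k (obs X Y δ 0 ω) ∂P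

variable {P : Measure Ω} {X : ℕ → Ω → 𝒳} {Y : ℕ → Ω → 𝒴} {δ : ℕ → Ω → ℝ}
  {b : 𝒳 → Fin L → ℝ} {U : 𝒳 → 𝒴 → EuclideanSpace ℝ (Fin q)} {lam : Fin (L + 1) → ℝ}

theorem gram_det_ne_zero (hr : Regularity P X Y δ b U lam) : (gram P X Y δ b lam).det ≠ 0 :=
  hr.nonsingular

variable [IsProbabilityMeasure P]

theorem gram_posDef (hs : IsIIDSample P X Y δ) (hr : Regularity P X Y δ b U lam) :
    (gram P X Y δ b lam).PosDef := by
  have hpsd : (gram P X Y δ b lam).PosSemidef := by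
    rw [Matrix.posSemidef_iff_dotProduct_mulVec]
    refine ⟨?_, fun d => ?_⟩
    · ext j k
      simp only [Matrix.conjTranspose_apply, gram, Matrix.of_apply, star_trivial, tiltedZZ, tiltedZ]
      exact integral_congr_ae (ae_of_all _ fun ω => by ring)
    · have h : d ⬝ᵥ (gram P X Y δ b lam).mulVec d =
          ∫ ω, δ 0 ω * expTilt b lam (X 0 ω) * (zvec b (X 0 ω) ⬝ᵥ d) ^ 2 ∂P := by
        have hi : ∀ j k, Integrable
            (fun ω => d j * (tiltedZZ b lam j k (obs X Y δ 0 ω) * d k)) P :=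
          fun j k => ((integrable_tiltedZZ hr j k).mul_const _).const_mul _
        simp only [dotProduct, Matrix.mulVec, gram, Matrix.of_apply, Finset.mul_sum]
        simp_rw [← integral_mul_const, ← integral_const_mul]
        simp_rw [← integral_finsetSum _ fun k _ => hi _ k]
        rw [← integral_finsetSum _ fun j _ => integrable_finsetSum _ fun k _ => hi j k]
        refine integral_congr_ae (ae_of_all _ fun ω => ?_)
        simp only [tiltedZZ, tiltedZ, obs]
        rw [pow_two, Finset.sum_mul_sum, Finset.mul_sum]
        refine Finset.sum_congr rfl fun j _ => ?_
        rw [Finset.mul_sum]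
        exact Finset.sum_congr rfl fun k _ => by ring
      rw [star_trivial, h]
      exact integral_nonneg fun ω =>
        mul_nonneg (mul_nonneg (hs.nonneg 0 ω) (expTilt_pos _ _ _).le) (sq_nonneg _)
  exact hpsd.posDef_iff_det_ne_zero.2 (gram_det_ne_zero hr)

theorem tendsto_sampleGram (hs : IsIIDSample P X Y δ) (hr : Regularity P X Y δ b U lam) :
    Tendsto (sampleGram X Y δ b lam) (inProb P) (𝓝 (gram P X Y δ b lam)) := by
  refine tendsto_pi_nhds.2 fun j => tendsto_pi_nhds.2 fun k => ?_
  exact tendsto_sampleMean hs.iIndepFun_obs hs.identDistrib_obs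
    (measurable_tiltedZZ hr.measurable_b j k) (integrable_tiltedZZ hr j k)

theorem integral_tiltedZ_smul_resid (hr : Regularity P X Y δ b U lam)
    (β : Fin (L + 1) → EuclideanSpace ℝ (Fin q)) (k : Fin (L + 1)) :
    ∫ ω, tiltedZ b lam k (obs X Y δ 0 ω) • resid b U β (obs X Y δ 0 ω) ∂P =
      ∫ ω, tiltedZU b U lam k (obs X Y δ 0 ω) ∂P - matAct (gram P X Y δ b lam) β k := by
  have hi : ∀ j, Integrable (fun ω => tiltedZZ b lam k j (obs X Y δ 0 ω) • β j) P :=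
    fun j => (integrable_tiltedZZ hr k j).smul_const _
  simp_rw [tiltedZ_smul_resid]
  rw [integral_sub (integrable_tiltedZU hr k) (integrable_finsetSum _ fun j _ => hi j),
    integral_finsetSum _ fun j _ => hi j]
  simp only [integral_smul_const, matAct, gram, Matrix.of_apply]

/-- The population normal equations characterize `popBeta`. -/
theorem eq_popBeta_iff (hr : Regularity P X Y δ b U lam)
    (β : Fin (L + 1) → EuclideanSpace ℝ (Fin q)) :
    β = popBeta P X Y δ b U lam ↔
      ∀ k, ∫ ω, tiltedZ b lam k (obs X Y δ 0 ω) • resid b U β (obs X Y δ 0 ω) ∂P = 0 := by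
  rw [popBeta, ← matAct_eq_iff (gram_det_ne_zero hr), funext_iff]
  refine forall_congr' fun k => ?_
  rw [integral_tiltedZ_smul_resid hr, sub_eq_zero, eq_comm]

theorem isWLSLimit_popBeta (hs : IsIIDSample P X Y δ) (hr : Regularity P X Y δ b U lam) :
    IsWLSLimit P X Y δ b U lam (popBeta P X Y δ b U lam) := by
  have hG := tendsto_sampleGram hs hr
  have hdet : ∀ᶠ x in inProb P, (sampleGram X Y δ b lam x).det ≠ 0 :=
    (((continuous_id.matrix_det).tendsto _).comp hG).eventually_ne (gram_det_ne_zero hr)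
  have hC : Tendsto (fun x => fun k => sampleMean (obs X Y δ) (tiltedZU b U lam k) x) (inProb P)
      (𝓝 fun k => ∫ ω, tiltedZU b U lam k (obs X Y δ 0 ω) ∂P) :=
    tendsto_pi_nhds.2 fun k => tendsto_sampleMean hs.iIndepFun_obs hs.identDistrib_obs
      (measurable_tiltedZU hr.measurable_b hr.measurable_U k) (integrable_tiltedZU hr k)
  have hsol : ∀ᶠ x in inProb P, ∀ β, IsWLS X Y δ b U lam x.1 x.2 β ↔
      β = matAct (sampleGram X Y δ b lam x)⁻¹
        fun k => sampleMean (obs X Y δ) (tiltedZU b U lam k) x := by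
    filter_upwards [hdet, tendsto_fst_inProb.eventually_gt_atTop 0] with x hx hN β
    rw [isWLS_iff hN, matAct_eq_iff hx]
  constructor
  · have h : ∀ᶠ x in inProb P, ∃! β', IsWLS X Y δ b U lam x.1 x.2 β' := by
      filter_upwards [hsol] with x hx
      exact ⟨_, (hx _).2 rfl, fun β hβ => (hx β).1 hβ⟩
    exact eventually_inProb.1 h
  · intro betaHat hbeta
    rw [tendstoInMeasure_const_iff]
    refine (tendsto_matAct_inv (gram_det_ne_zero hr) hG hC).congr' ?_
    filter_upwards [hsol] with x hx
    exact ((hx _).1 (hbeta x.1 x.2 ⟨_, (hx _).2 rfl⟩)).symm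

end WeightedLeastSquares

/-! ### The calibration equation and the expansion error -/

section Calibration

variable {Ω 𝒳 𝒴 : Type*} {L q : ℕ}

/-- The odds `N₀ / N₁` of nonresponse in the sample. -/
noncomputable def missOdds (δ : ℕ → Ω → ℝ) (x : ℕ × Ω) : ℝ :=
  numMis δ x.1 x.2 / numObs δ x.1 x.2

/-- The response rate `N₁ / N`. -/
noncomputable def respRate (δ : ℕ → Ω → ℝ) : ℕ × Ω → ℝ := sampleMean δ id

theorem missOdds_eq (δ : ℕ → Ω → ℝ) {x : ℕ × Ω} (hN : 0 < x.1) :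
    missOdds δ x = (1 - respRate δ x) / respRate δ x := by
  have hN' : (x.1 : ℝ) ≠ 0 := by exact_mod_cast hN.ne'
  simp only [missOdds, numMis, respRate, sampleMean, id, smul_eq_mul, numObs]
  rw [← mul_div_mul_left (1 - _) _ hN', mul_sub, mul_inv_cancel_left₀ hN', mul_one]

/-- The calibration equation, normalized by `N` and written in terms of the deviation from `lam`:
the left side minus the right side at `lam + d`. -/
noncomputable def calScore (X : ℕ → Ω → 𝒳) (Y : ℕ → Ω → 𝒴) (δ : ℕ → Ω → ℝ) (b : 𝒳 → Fin L → ℝ)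
    (lam : Fin (L + 1) → ℝ) (x : ℕ × Ω) (d : Fin (L + 1) → ℝ) : Fin (L + 1) → ℝ :=
  tiltScore (Finset.range x.1)
    (fun i => missOdds δ x * ((x.1 : ℝ)⁻¹ * (δ i x.2 * expTilt b lam (X i x.2))))
    (fun i => zvec b (X i x.2)) (fun k => sampleMean (obs X Y δ) (missingZ b k) x) d

theorem calScore_zero_apply (X : ℕ → Ω → 𝒳) (Y : ℕ → Ω → 𝒴) (δ : ℕ → Ω → ℝ)
    (b : 𝒳 → Fin L → ℝ) (lam : Fin (L + 1) → ℝ) (x : ℕ × Ω) (k : Fin (L + 1)) :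
    calScore X Y δ b lam x 0 k = missOdds δ x * sampleMean (obs X Y δ) (tiltedZ b lam k) x -
      sampleMean (obs X Y δ) (missingZ b k) x := by
  simp only [calScore, tiltScore, dotProduct_zero, Real.exp_zero, mul_one, Pi.sub_apply,
    Finset.sum_apply, Pi.smul_apply, smul_eq_mul, sampleMean, obs, tiltedZ, Finset.mul_sum,
    mul_assoc]

theorem isCalibration_iff {X : ℕ → Ω → 𝒳} (Y : ℕ → Ω → 𝒴) {δ : ℕ → Ω → ℝ} {b : 𝒳 → Fin L → ℝ}
    (lam : Fin (L + 1) → ℝ) {x : ℕ × Ω} (hN : 0 < x.1) {l : Fin (L + 1) → ℝ} :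
    IsCalibration X δ b x.1 x.2 l ↔ calScore X Y δ b lam x (l - lam) = 0 := by
  have hN' : (x.1 : ℝ)⁻¹ ≠ 0 := inv_ne_zero (by exact_mod_cast hN.ne')
  have h : calScore X Y δ b lam x (l - lam) = (x.1 : ℝ)⁻¹ •
      (∑ i ∈ Finset.range x.1, (δ i x.2 * weight δ b x.1 x.2 l (X i x.2)) • zvec b (X i x.2) -
        ∑ i ∈ Finset.range x.1, zvec b (X i x.2)) := by
    ext k
    simp only [calScore, tiltScore, Pi.sub_apply, Finset.sum_apply, Pi.smul_apply, smul_eq_mul,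
      sampleMean, obs, missingZ, weight, expTilt_eq_mul b lam l, missOdds]
    rw [← Finset.sum_sub_distrib, Finset.mul_sum, Finset.mul_sum, ← Finset.sum_sub_distrib]
    exact Finset.sum_congr rfl fun i _ => by ring
  rw [h, smul_eq_zero_iff_right hN', sub_eq_zero, IsCalibration]

/-- Calibration removes the regression part: the difference to the linear term only involves the
residuals, multiplied by the change in the weights. -/
theorem estFun_sub_linTerm {X : ℕ → Ω → 𝒳} (Y : ℕ → Ω → 𝒴) {δ : ℕ → Ω → ℝ}
    {b : 𝒳 → Fin L → ℝ} (U : 𝒳 → 𝒴 → EuclideanSpace ℝ (Fin q)) (lam : Fin (L + 1) → ℝ)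
    (β : Fin (L + 1) → EuclideanSpace ℝ (Fin q)) {N : ℕ} {ω : Ω} {l : Fin (L + 1) → ℝ}
    (hl : IsCalibration X δ b N ω l) :
    estFun X Y δ b U N ω l - linTerm X Y δ b U lam β N ω =
      missOdds δ (N, ω) • (N : ℝ)⁻¹ • ∑ i ∈ Finset.range N,
        (δ i ω * expTilt b lam (X i ω) * (Real.exp (zvec b (X i ω) ⬝ᵥ (l - lam)) - 1)) •
          resid b U β (obs X Y δ i ω) := by
  have hcal : ∑ i ∈ Finset.range N, linPred b β (X i ω) =
      ∑ i ∈ Finset.range N, (δ i ω * weight δ b N ω l (X i ω)) • linPred b β (X i ω) := by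
    have hk := fun k => congrFun hl k
    simp only [Finset.sum_apply, Pi.smul_apply, smul_eq_mul] at hk
    simp only [linPred, Finset.smul_sum, smul_smul]
    refine Finset.sum_comm.trans (Eq.trans ?_ Finset.sum_comm)
    refine Finset.sum_congr rfl fun k _ => ?_
    rw [← Finset.sum_smul, ← Finset.sum_smul]
    exact congrArg (fun r : ℝ => r • β k) (hk k).symm
  rw [estFun, linTerm, Finset.sum_add_distrib, hcal, ← Finset.sum_add_distrib, ← smul_sub,
    ← Finset.sum_sub_distrib, smul_comm (missOdds δ (N, ω))]
  congr 1
  rw [Finset.smul_sum]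
  refine Finset.sum_congr rfl fun i _ => ?_
  have hw : δ i ω * weight δ b N ω l (X i ω) = δ i ω * weight δ b N ω lam (X i ω) +
      missOdds δ (N, ω) * (δ i ω * expTilt b lam (X i ω) *
        (Real.exp (zvec b (X i ω) ⬝ᵥ (l - lam)) - 1)) := by
    simp only [weight, expTilt_eq_mul b lam l, missOdds]
    ring
  rw [hw, resid, obs, smul_smul]
  module

theorem norm_zvec_cube_le (b : 𝒳 → Fin L → ℝ) (x : 𝒳) {ρ : ℝ} (hρ : 0 < ρ) :
    ‖zvec b x‖ ^ 3 ≤ 48 / ρ ^ 3 * Real.exp (ρ / 2 * ‖zvec b x‖) := by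
  have h := Real.pow_div_factorial_le_exp (ρ / 2 * ‖zvec b x‖) (by positivity) 3
  have h6 : ((3 : ℕ).factorial : ℝ) = 6 := by norm_num [Nat.factorial]
  rw [h6] at h
  calc ‖zvec b x‖ ^ 3 = 48 / ρ ^ 3 * ((ρ / 2 * ‖zvec b x‖) ^ 3 / 6) := by field_simp; ring
    _ ≤ _ := by gcongr

/-- The cubic weights are dominated by the envelope. -/
theorem tilt_cube_le_envelope (b : 𝒳 → Fin L → ℝ) (U : 𝒳 → 𝒴 → EuclideanSpace ℝ (Fin q))
    (lam : Fin (L + 1) → ℝ) {ρ : ℝ} (hρ : 0 < ρ) {w : 𝒳 × 𝒴 × ℝ} (hw : 0 ≤ w.2.2) :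
    w.2.2 * expTilt b lam w.1 * ‖zvec b w.1‖ ^ 3 ≤ 48 / ρ ^ 3 * envelope b U lam ρ w := by
  have he := (expTilt_pos b lam w.1).le
  have h1 : Real.exp (ρ / 2 * ‖zvec b w.1‖) ≤
      Real.exp (ρ * ‖zvec b w.1‖) * (1 + ‖U w.1 w.2.1‖) := by
    calc Real.exp (ρ / 2 * ‖zvec b w.1‖) ≤ Real.exp (ρ * ‖zvec b w.1‖) * 1 := by
          rw [mul_one]; gcongr; linarith
      _ ≤ _ := by gcongr; linarith [norm_nonneg (U w.1 w.2.1)]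
  calc w.2.2 * expTilt b lam w.1 * ‖zvec b w.1‖ ^ 3
      ≤ w.2.2 * expTilt b lam w.1 * (48 / ρ ^ 3 * (Real.exp (ρ * ‖zvec b w.1‖) *
        (1 + ‖U w.1 w.2.1‖))) := by
        gcongr
        exact (norm_zvec_cube_le b w.1 hρ).trans (by gcongr)
    _ = _ := by rw [envelope]; ring

/-- The second-order Taylor remainder of the tilted residual is dominated by the envelope. -/
theorem norm_taylor_smul_resid_le (b : 𝒳 → Fin L → ℝ) (U : 𝒳 → 𝒴 → EuclideanSpace ℝ (Fin q))
    (lam : Fin (L + 1) → ℝ) (β : Fin (L + 1) → EuclideanSpace ℝ (Fin q)) {ρ : ℝ} (hρ : 0 < ρ)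
    {w : 𝒳 × 𝒴 × ℝ} (hw : 0 ≤ w.2.2) {d : Fin (L + 1) → ℝ} (hd : ((L : ℝ) + 1) * ‖d‖ ≤ ρ / 2) :
    ‖(w.2.2 * expTilt b lam w.1 * (Real.exp (zvec b w.1 ⬝ᵥ d) - 1 - zvec b w.1 ⬝ᵥ d)) •
      resid b U β w‖ ≤
      ((L : ℝ) + 1) ^ 2 * (1 + ∑ k, ‖β k‖) * (48 / ρ ^ 3) * ‖d‖ ^ 2 * envelope b U lam ρ w := by
  set m := ‖zvec b w.1‖ with hm
  set t := zvec b w.1 ⬝ᵥ d with ht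
  set B := ∑ k, ‖β k‖ with hB
  set u := ‖U w.1 w.2.1‖ with hu
  have hB0 : 0 ≤ B := Finset.sum_nonneg fun k _ => norm_nonneg _
  have hu0 : 0 ≤ u := norm_nonneg _
  have hm1 : 1 ≤ m := one_le_norm_zvec b w.1
  have he := (expTilt_pos b lam w.1).le
  have htabs : |t| ≤ ((L : ℝ) + 1) * m * ‖d‖ := by
    simpa using abs_dotProduct_le (zvec b w.1) d
  have htρ : |t| ≤ ρ / 2 * m := by
    calc |t| ≤ (((L : ℝ) + 1) * ‖d‖) * m := by linarith
      _ ≤ ρ / 2 * m := by gcongr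
  have hresid : ‖resid b U β w‖ ≤ (1 + B) * m * (1 + u) := by
    calc ‖resid b U β w‖ ≤ u + B * m :=
          (norm_sub_le _ _).trans (add_le_add le_rfl (norm_linPred_le b β w.1))
      _ ≤ (1 + B) * m * (1 + u) := by
          nlinarith [mul_nonneg hB0 hu0, mul_nonneg hu0 (sub_nonneg.2 hm1),
            mul_nonneg (mul_nonneg hB0 hu0) (sub_nonneg.2 hm1)]
  have hrem : |Real.exp t - 1 - t| ≤ ((L : ℝ) + 1) ^ 2 * m ^ 2 * ‖d‖ ^ 2 *
      Real.exp (ρ / 2 * m) := by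
    refine (abs_exp_sub_one_sub_le t).trans ?_
    have : t ^ 2 ≤ ((L : ℝ) + 1) ^ 2 * m ^ 2 * ‖d‖ ^ 2 := by
      rw [← sq_abs, ← mul_pow, ← mul_pow]
      gcongr
    gcongr
  have hcube : m ^ 3 ≤ 48 / ρ ^ 3 * Real.exp (ρ / 2 * m) := norm_zvec_cube_le b w.1 hρ
  have hR0 : 0 ≤ ‖resid b U β w‖ := norm_nonneg _
  have hexp : Real.exp (ρ / 2 * m) * Real.exp (ρ / 2 * m) = Real.exp (ρ * m) := by
    rw [← Real.exp_add]; congr 1; ring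
  have henv : envelope b U lam ρ w =
      w.2.2 * expTilt b lam w.1 * (Real.exp (ρ * m) * (1 + u)) := rfl
  rw [norm_smul, Real.norm_eq_abs, abs_mul, abs_of_nonneg (mul_nonneg hw he), henv, ← hexp]
  generalize ‖resid b U β w‖ = R at hresid hR0 ⊢
  clear_value m t B u
  calc w.2.2 * expTilt b lam w.1 * |Real.exp t - 1 - t| * R
      ≤ w.2.2 * expTilt b lam w.1 * (((L : ℝ) + 1) ^ 2 * m ^ 2 * ‖d‖ ^ 2 *
        Real.exp (ρ / 2 * m)) * ((1 + B) * m * (1 + u)) := by gcongr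
    _ = w.2.2 * expTilt b lam w.1 * (((L : ℝ) + 1) ^ 2 * (1 + B) * ‖d‖ ^ 2 * (1 + u)) *
        (Real.exp (ρ / 2 * m) * m ^ 3) := by ring
    _ ≤ w.2.2 * expTilt b lam w.1 * (((L : ℝ) + 1) ^ 2 * (1 + B) * ‖d‖ ^ 2 * (1 + u)) *
        (Real.exp (ρ / 2 * m) * (48 / ρ ^ 3 * Real.exp (ρ / 2 * m))) :=
        mul_le_mul_of_nonneg_left (mul_le_mul_of_nonneg_left hcube (Real.exp_pos _).le)
          (mul_nonneg (mul_nonneg hw he) (by positivity))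
    _ = _ := by ring

end Calibration

/-! ### The asymptotic linear expansion -/

section Expansion

variable {Ω 𝒳 𝒴 : Type*} {L q : ℕ} [MeasurableSpace Ω] [MeasurableSpace 𝒳] [MeasurableSpace 𝒴]

/-- The population calibration equation at `lam`:
`((1 - p) / p) E{δ exp(zᵀ λ) z} = E{(1 - δ) z}`, `p = P(δ = 1)`. -/
def Balanced (P : Measure Ω) (X : ℕ → Ω → 𝒳) (Y : ℕ → Ω → 𝒴) (δ : ℕ → Ω → ℝ)
    (b : 𝒳 → Fin L → ℝ) (lam : Fin (L + 1) → ℝ) : Prop :=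
  ∀ k, (1 - P.real {ω | δ 0 ω = 1}) / P.real {ω | δ 0 ω = 1} *
    ∫ ω, tiltedZ b lam k (obs X Y δ 0 ω) ∂P = ∫ ω, missingZ b k (obs X Y δ 0 ω) ∂P

variable {P : Measure Ω} {X : ℕ → Ω → 𝒳} {Y : ℕ → Ω → 𝒴}
  {δ : ℕ → Ω → ℝ} {b : 𝒳 → Fin L → ℝ} {U : 𝒳 → 𝒴 → EuclideanSpace ℝ (Fin q)}
  {lam : Fin (L + 1) → ℝ}

theorem IsIIDSample.iIndepFun_delta (hs : IsIIDSample P X Y δ) : iIndepFun δ P :=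
  hs.iIndepFun_obs.comp (fun _ w => w.2.2) fun _ => measurable_snd.snd

theorem IsIIDSample.identDistrib_delta (hs : IsIIDSample P X Y δ) (i : ℕ) :
    IdentDistrib (δ i) (δ 0) P P :=
  (hs.identDistrib_obs i).comp (u := fun w : 𝒳 × 𝒴 × ℝ => w.2.2) measurable_snd.snd

theorem odds_pos (hs : IsIIDSample P X Y δ) :
    0 < (1 - P.real {ω | δ 0 ω = 1}) / P.real {ω | δ 0 ω = 1} :=
  div_pos (sub_pos.2 hs.prob_lt_one) hs.prob_pos

/-- Bound of the expansion error for a solution of the calibration equation near `lam`. -/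
theorem norm_estFun_sub_linTerm_le (hs : IsIIDSample P X Y δ)
    (U : 𝒳 → 𝒴 → EuclideanSpace ℝ (Fin q)) (lam : Fin (L + 1) → ℝ)
    (β : Fin (L + 1) → EuclideanSpace ℝ (Fin q)) {ρ : ℝ} (hρ : 0 < ρ) {x : ℕ × Ω}
    {l : Fin (L + 1) → ℝ} (hl : IsCalibration X δ b x.1 x.2 l)
    (hd : ((L : ℝ) + 1) * ‖l - lam‖ ≤ ρ / 2) :
    ‖estFun X Y δ b U x.1 x.2 l - linTerm X Y δ b U lam β x.1 x.2‖ ≤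
      |missOdds δ x| * (∑ k, ‖sampleMean (obs X Y δ)
          (fun w => tiltedZ b lam k w • resid b U β w) x‖ +
        ((L : ℝ) + 1) ^ 2 * (1 + ∑ k, ‖β k‖) * (48 / ρ ^ 3) *
          sampleMean (obs X Y δ) (envelope b U lam ρ) x * ‖l - lam‖) * ‖l - lam‖ := by
  set d := l - lam with hddef
  set C := ((L : ℝ) + 1) ^ 2 * (1 + ∑ k, ‖β k‖) * (48 / ρ ^ 3) with hC
  -- write `exp t - 1 = t + (exp t - 1 - t)`
  have hsplit : (x.1 : ℝ)⁻¹ • ∑ i ∈ Finset.range x.1,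
      (δ i x.2 * expTilt b lam (X i x.2) * (Real.exp (zvec b (X i x.2) ⬝ᵥ d) - 1)) •
        resid b U β (obs X Y δ i x.2) =
      ∑ k, d k • sampleMean (obs X Y δ) (fun w => tiltedZ b lam k w • resid b U β w) x +
      (x.1 : ℝ)⁻¹ • ∑ i ∈ Finset.range x.1, (δ i x.2 * expTilt b lam (X i x.2) *
        (Real.exp (zvec b (X i x.2) ⬝ᵥ d) - 1 - zvec b (X i x.2) ⬝ᵥ d)) •
          resid b U β (obs X Y δ i x.2) := by
    have h1 : ∑ k, d k • sampleMean (obs X Y δ) (fun w => tiltedZ b lam k w • resid b U β w) x =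
        (x.1 : ℝ)⁻¹ • ∑ i ∈ Finset.range x.1,
          (δ i x.2 * expTilt b lam (X i x.2) * (zvec b (X i x.2) ⬝ᵥ d)) •
            resid b U β (obs X Y δ i x.2) := by
      simp only [sampleMean, Finset.smul_sum, smul_smul]
      rw [Finset.sum_comm]
      refine Finset.sum_congr rfl fun i _ => ?_
      rw [← Finset.sum_smul]
      congr 1
      simp only [dotProduct, Finset.mul_sum, tiltedZ, obs]
      exact Finset.sum_congr rfl fun k _ => by ring
    rw [h1, ← smul_add, ← Finset.sum_add_distrib]
    congr 1
    refine Finset.sum_congr rfl fun i _ => ?_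
    rw [← add_smul]
    congr 1
    ring
  have hlin : ‖∑ k, d k • sampleMean (obs X Y δ)
      (fun w => tiltedZ b lam k w • resid b U β w) x‖ ≤
      (∑ k, ‖sampleMean (obs X Y δ) (fun w => tiltedZ b lam k w • resid b U β w) x‖) * ‖d‖ := by
    rw [Finset.sum_mul]
    refine (norm_sum_le _ _).trans (Finset.sum_le_sum fun k _ => ?_)
    rw [norm_smul, mul_comm]
    gcongr
    exact norm_le_pi_norm d k
  have hrem : ‖(x.1 : ℝ)⁻¹ • ∑ i ∈ Finset.range x.1, (δ i x.2 * expTilt b lam (X i x.2) *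
        (Real.exp (zvec b (X i x.2) ⬝ᵥ d) - 1 - zvec b (X i x.2) ⬝ᵥ d)) •
          resid b U β (obs X Y δ i x.2)‖ ≤
      C * sampleMean (obs X Y δ) (envelope b U lam ρ) x * ‖d‖ * ‖d‖ := by
    rw [norm_smul, Real.norm_of_nonneg (by positivity)]
    calc _ ≤ (x.1 : ℝ)⁻¹ * ∑ i ∈ Finset.range x.1,
          C * ‖d‖ ^ 2 * envelope b U lam ρ (obs X Y δ i x.2) := by
          refine mul_le_mul_of_nonneg_left ((norm_sum_le _ _).trans
            (Finset.sum_le_sum fun i _ => ?_)) (by positivity)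
          exact norm_taylor_smul_resid_le b U lam β hρ (w := obs X Y δ i x.2) (hs.nonneg i _) hd
      _ = _ := by
          rw [← Finset.mul_sum, sampleMean, smul_eq_mul]; ring
  rw [estFun_sub_linTerm Y U lam β hl, hsplit, norm_smul, Real.norm_eq_abs, mul_assoc]
  refine mul_le_mul_of_nonneg_left ?_ (abs_nonneg _)
  refine (norm_add_le _ _).trans ((add_le_add hlin hrem).trans_eq ?_)
  ring

variable [IsProbabilityMeasure P]

theorem tendsto_respRate (hs : IsIIDSample P X Y δ) :
    Tendsto (respRate δ) (inProb P) (𝓝 (P.real {ω | δ 0 ω = 1})) := by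
  rw [← integral_delta hs]
  exact tendsto_sampleMean hs.iIndepFun_delta hs.identDistrib_delta measurable_id
    (integrable_delta hs 0)

theorem boundedInProb_respRate (hs : IsIIDSample P X Y δ) :
    BoundedInProb P fun x => √(x.1 : ℝ) * (respRate δ x - P.real {ω | δ 0 ω = 1}) := by
  rw [← integral_delta hs]
  exact boundedInProb_sampleMean hs.iIndepFun_delta hs.identDistrib_delta measurable_id
    (MemLp.of_bound (hs.measurable_δ 0).aestronglyMeasurable 1 (ae_of_all _ (hs.abs_le_one 0)))

theorem tendsto_missOdds (hs : IsIIDSample P X Y δ) :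
    Tendsto (missOdds δ) (inProb P)
      (𝓝 ((1 - P.real {ω | δ 0 ω = 1}) / P.real {ω | δ 0 ω = 1})) := by
  have h := tendsto_respRate hs
  refine ((tendsto_const_nhds.sub h).div h hs.prob_pos.ne').congr' ?_
  filter_upwards [tendsto_fst_inProb.eventually_gt_atTop 0] with x hN
  exact (missOdds_eq δ hN).symm

theorem tendsto_calScore_zero (hs : IsIIDSample P X Y δ) (hr : Regularity P X Y δ b U lam)
    (hbal : Balanced P X Y δ b lam) :
    Tendsto (fun x => calScore X Y δ b lam x 0) (inProb P) (𝓝 0) := by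
  refine tendsto_pi_nhds.2 fun k => ?_
  simp only [calScore_zero_apply]
  have h := ((tendsto_missOdds hs).mul (tendsto_sampleMean hs.iIndepFun_obs hs.identDistrib_obs
    (measurable_tiltedZ hr.measurable_b k) ((memLp_tiltedZ hr k).integrable (by norm_num)))).sub
    (tendsto_sampleMean hs.iIndepFun_obs hs.identDistrib_obs
    (measurable_missingZ hr.measurable_b k) ((memLp_missingZ hs hr k).integrable (by norm_num)))
  rwa [hbal k, sub_self] at h

/-- The score of the calibration equation at `lam` is of order `N^{-1/2}`. -/
theorem boundedInProb_calScore_zero (hs : IsIIDSample P X Y δ) (hr : Regularity P X Y δ b U lam)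
    (hbal : Balanced P X Y δ b lam) :
    BoundedInProb P fun x => √(x.1 : ℝ) * ‖calScore X Y δ b lam x 0‖ := by
  set p := P.real {ω | δ 0 ω = 1} with hp
  have hp0 : 0 < p := hs.prob_pos
  have hk : ∀ k, BoundedInProb P fun x => √(x.1 : ℝ) * calScore X Y δ b lam x 0 k := by
    intro k
    set A := ∫ ω, tiltedZ b lam k (obs X Y δ 0 ω) ∂P with hA
    set B := ∫ ω, missingZ b k (obs X Y δ 0 ω) ∂P with hB
    have hAB : (1 - p) / p * A = B := hbal k
    have h1 := BoundedInProb.tendsto_mul (tendsto_missOdds hs)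
      (boundedInProb_sampleMean hs.iIndepFun_obs hs.identDistrib_obs
        (measurable_tiltedZ hr.measurable_b k) (memLp_tiltedZ hr k))
    have h2 := BoundedInProb.tendsto_mul (tendsto_const_nhds (x := (-1 : ℝ)))
      (boundedInProb_sampleMean hs.iIndepFun_obs hs.identDistrib_obs
        (measurable_missingZ hr.measurable_b k) (memLp_missingZ hs hr k))
    have h3 := BoundedInProb.tendsto_mul
      (((tendsto_respRate hs).inv₀ hp0.ne').mul_const (-(A / p))) (boundedInProb_respRate hs)
    refine ((h1.add h2).add h3).congr' ?_
    filter_upwards [tendsto_fst_inProb.eventually_gt_atTop 0,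
      (tendsto_respRate hs).eventually_ne hp0.ne'] with x hN hx
    rw [calScore_zero_apply, missOdds_eq δ hN, ← hA, ← hB, ← hAB, ← hp]
    field_simp
    ring
  refine (BoundedInProb.sum Finset.univ fun k _ => (hk k).abs).mono ?_
  refine Eventually.of_forall fun x => ?_
  have h0 : 0 ≤ ∑ k, |calScore X Y δ b lam x 0 k| := Finset.sum_nonneg fun k _ => abs_nonneg _
  have hle : ‖calScore X Y δ b lam x 0‖ ≤ ∑ k, |calScore X Y δ b lam x 0 k| :=
    (pi_norm_le_iff_of_nonneg h0).2 fun k =>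
      Finset.single_le_sum (f := fun k => |calScore X Y δ b lam x 0 k|)
        (fun k _ => abs_nonneg _) (Finset.mem_univ k)
  have e : ∑ k, |√(x.1 : ℝ) * calScore X Y δ b lam x 0 k| =
      √(x.1 : ℝ) * ∑ k, |calScore X Y δ b lam x 0 k| := by
    simp only [abs_mul, abs_of_nonneg (Real.sqrt_nonneg _), Finset.mul_sum]
  rw [e, abs_of_nonneg (by positivity), abs_of_nonneg (by positivity)]
  gcongr

/-- With probability tending to one the calibration equation has exactly one solution, and the
distance of this solution to `lam` is at most a multiple of the score at `lam`. -/
theorem eventually_isCalibration_iff (hs : IsIIDSample P X Y δ) (hr : Regularity P X Y δ b U lam)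
    (hbal : Balanced P X Y δ b lam) :
    ∃ K, 0 < K ∧ ∀ᶠ x in inProb P, ∃ l₀, ‖l₀ - lam‖ ≤ K * ‖calScore X Y δ b lam x 0‖ ∧
      ∀ l, IsCalibration X δ b x.1 x.2 l ↔ l = l₀ := by
  obtain ⟨c, hc, hquad⟩ := eventually_quadratic_form_ge (gram_posDef hs hr)
  obtain ⟨ρ, hρ, henv⟩ := exists_integrable_envelope hs hr
  have hκ := odds_pos hs
  have hlimκ := tendsto_missOdds hs
  set κ := (1 - P.real {ω | δ 0 ω = 1}) / P.real {ω | δ 0 ω = 1} with hκdef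
  have hlimE := (hlimκ.mul (tendsto_sampleMean hs.iIndepFun_obs hs.identDistrib_obs
    (measurable_envelope hr.measurable_b hr.measurable_U ρ) henv)).const_mul (48 / ρ ^ 3)
  have hE0 : 0 ≤ ∫ ω, envelope b U lam ρ (obs X Y δ 0 ω) ∂P := integral_nonneg fun ω =>
    mul_nonneg (mul_nonneg (hs.nonneg 0 ω) (expTilt_pos _ _ _).le) (by positivity)
  -- limit of the bound on the weighted third moment of the regressors
  set T₀ := 48 / ρ ^ 3 * (κ * ∫ ω, envelope b U lam ρ (obs X Y δ 0 ω) ∂P) with hT₀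
  have hT₀0 : 0 ≤ T₀ := by positivity
  set T := T₀ + 1 with hT
  have hT0 : 0 < T := by positivity
  set n : ℝ := (Fintype.card (Fin (L + 1)) : ℝ) with hn
  have hn0 : 0 < n := by simp only [hn, Fintype.card_fin]; positivity
  -- the odds exceed half of their limit with probability tending to one
  set c' := κ / 2 * c with hc'
  have hc'0 : 0 < c' := by positivity
  -- a radius on which the quadratic part dominates the cubic remainder
  set r := c' / (n ^ 3 * T) with hr'
  have hr0 : 0 < r := by positivity
  have hscore : ∀ᶠ x in inProb P, n * ‖calScore X Y δ b lam x 0‖ < c' / 8 * r := by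
    have h := (tendsto_calScore_zero hs hr hbal).norm.const_mul n
    rw [norm_zero, mul_zero] at h
    exact h.eventually_lt_const (by positivity)
  refine ⟨8 * n / c', by positivity, ?_⟩
  filter_upwards [tendsto_fst_inProb.eventually_gt_atTop 0,
    hlimκ.eventually_const_lt (half_lt_self hκ), (tendsto_sampleGram hs hr).eventually hquad,
    hlimE.eventually_lt_const (lt_add_one T₀), hscore] with x hN hxκ hxq hxE hxs
  have hκx : 0 < missOdds δ x := (half_pos hκ).trans hxκ
  have hN' : (0 : ℝ) < x.1 := by exact_mod_cast hN
  have ha : ∀ i ∈ Finset.range x.1,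
      0 ≤ missOdds δ x * ((x.1 : ℝ)⁻¹ * (δ i x.2 * expTilt b lam (X i x.2))) := fun i _ =>
    mul_nonneg hκx.le (mul_nonneg (by positivity)
      (mul_nonneg (hs.nonneg i _) (expTilt_pos _ _ _).le))
  have hQ : ∀ d : Fin (L + 1) → ℝ, c' * ‖d‖ ^ 2 ≤ ∑ i ∈ Finset.range x.1,
      missOdds δ x * ((x.1 : ℝ)⁻¹ * (δ i x.2 * expTilt b lam (X i x.2))) *
        (zvec b (X i x.2) ⬝ᵥ d) ^ 2 := by
    intro d
    have e : ∑ i ∈ Finset.range x.1,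
        missOdds δ x * ((x.1 : ℝ)⁻¹ * (δ i x.2 * expTilt b lam (X i x.2))) *
          (zvec b (X i x.2) ⬝ᵥ d) ^ 2 =
        missOdds δ x * (d ⬝ᵥ (sampleGram X Y δ b lam x).mulVec d) := by
      simp only [dotProduct, Matrix.mulVec, sampleGram, Matrix.of_apply, sampleMean, smul_eq_mul,
        Finset.mul_sum, Finset.sum_mul, tiltedZZ, tiltedZ, obs, pow_two]
      rw [Finset.sum_comm]
      refine Finset.sum_congr rfl fun j _ => ?_
      rw [Finset.sum_comm]
      exact Finset.sum_congr rfl fun k _ => Finset.sum_congr rfl fun i _ => by ring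
    rw [e, hc', mul_assoc]
    exact mul_le_mul hxκ.le (hxq d) (by positivity) hκx.le
  have hTx : ∑ i ∈ Finset.range x.1,
      missOdds δ x * ((x.1 : ℝ)⁻¹ * (δ i x.2 * expTilt b lam (X i x.2))) *
        ‖zvec b (X i x.2)‖ ^ 3 ≤ T := by
    refine le_trans ?_ hxE.le
    rw [sampleMean, smul_eq_mul, Finset.mul_sum, Finset.mul_sum, Finset.mul_sum]
    refine Finset.sum_le_sum fun i _ => ?_
    have h := tilt_cube_le_envelope b U lam hρ (w := obs X Y δ i x.2) (hs.nonneg i x.2)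
    calc _ = missOdds δ x * (x.1 : ℝ)⁻¹ *
          (δ i x.2 * expTilt b lam (X i x.2) * ‖zvec b (X i x.2)‖ ^ 3) := by ring
      _ ≤ missOdds δ x * (x.1 : ℝ)⁻¹ *
          (48 / ρ ^ 3 * envelope b U lam ρ (obs X Y δ i x.2)) :=
          mul_le_mul_of_nonneg_left h (by positivity)
      _ = _ := by ring
  have hTr : n ^ 3 * T * r ≤ c' := le_of_eq (by rw [hr']; field_simp)
  obtain ⟨d, -, hdle, hd⟩ := exists_tiltScore_eq_zero hr0 ha hQ hTx hTr hT0.le hxs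
  refine ⟨lam + d, ?_, fun l => ?_⟩
  · rw [add_sub_cancel_left, div_mul_eq_mul_div, le_div_iff₀ hc'0]
    have hdle' : c' / 8 * ‖d‖ ≤ n * ‖calScore X Y δ b lam x 0‖ := hdle
    linarith
  · rw [isCalibration_iff Y lam hN]
    constructor
    · intro hl
      rw [← tiltScore_injOn_zero hc'0 ha hQ hl hd]
      abel
    · rintro rfl
      rw [add_sub_cancel_left]
      exact hd

/-- The asymptotic linear expansion holds as soon as the population calibration equation does. -/
theorem expansion_of_balanced (hs : IsIIDSample P X Y δ) (hr : Regularity P X Y δ b U lam)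
    (hbal : Balanced P X Y δ b lam) :
    Expansion P X Y δ b U lam (popBeta P X Y δ b U lam) := by
  obtain ⟨K, hK, hsol⟩ := eventually_isCalibration_iff hs hr hbal
  have hscore := tendsto_calScore_zero hs hr hbal
  constructor
  · have h : ∀ᶠ x in inProb P, ∃! l, IsCalibration X δ b x.1 x.2 l := by
      filter_upwards [hsol] with x hx
      obtain ⟨l₀, -, hl₀⟩ := hx
      exact ⟨l₀, (hl₀ _).2 rfl, fun l hl => (hl₀ l).1 hl⟩
    exact eventually_inProb.1 h
  intro lamHat hlam
  have hcal : ∀ᶠ x in inProb P, IsCalibration X δ b x.1 x.2 (lamHat x.1 x.2) ∧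
      ‖lamHat x.1 x.2 - lam‖ ≤ K * ‖calScore X Y δ b lam x 0‖ := by
    filter_upwards [hsol] with x hx
    obtain ⟨l₀, hle, hl₀⟩ := hx
    have h1 := hlam x.1 x.2 ⟨l₀, (hl₀ _).2 rfl⟩
    exact ⟨h1, by rwa [(hl₀ _).1 h1]⟩
  have hconv : Tendsto (fun x : ℕ × Ω => lamHat x.1 x.2) (inProb P) (𝓝 lam) := by
    rw [tendsto_iff_norm_sub_tendsto_zero]
    refine squeeze_zero' (Eventually.of_forall fun _ => norm_nonneg _)
      (hcal.mono fun x hx => hx.2) ?_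
    simpa using hscore.norm.const_mul K
  refine ⟨tendstoInMeasure_const_iff.2 hconv, ?_⟩
  rw [tendstoInMeasure_const_iff]
  obtain ⟨ρ, hρ, henv⟩ := exists_integrable_envelope hs hr
  set β := popBeta P X Y δ b U lam with hβ
  have hresid0 := (eq_popBeta_iff hr β).1 hβ
  -- the expansion error is at most `G` times the score at `lam`
  set G : ℕ × Ω → ℝ := fun x => |missOdds δ x| * (∑ k, ‖sampleMean (obs X Y δ)
      (fun w => tiltedZ b lam k w • resid b U β w) x‖ +
    ((L : ℝ) + 1) ^ 2 * (1 + ∑ k, ‖β k‖) * (48 / ρ ^ 3) *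
      sampleMean (obs X Y δ) (envelope b U lam ρ) x * ‖lamHat x.1 x.2 - lam‖) * K with hG
  have hdist : Tendsto (fun x : ℕ × Ω => ‖lamHat x.1 x.2 - lam‖) (inProb P) (𝓝 0) :=
    tendsto_iff_norm_sub_tendsto_zero.1 hconv
  have hGlim : Tendsto G (inProb P) (𝓝 0) := by
    have h1 : Tendsto (fun x => ∑ k, ‖sampleMean (obs X Y δ)
        (fun w => tiltedZ b lam k w • resid b U β w) x‖) (inProb P) (𝓝 0) := by
      have hk : ∀ k, Tendsto (fun x => ‖sampleMean (obs X Y δ)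
          (fun w => tiltedZ b lam k w • resid b U β w) x‖) (inProb P) (𝓝 0) := fun k => by
        have h := tendsto_sampleMean (h := fun w => tiltedZ b lam k w • resid b U β w)
          hs.iIndepFun_obs hs.identDistrib_obs ((measurable_tiltedZ hr.measurable_b k).smul
            (measurable_resid hr.measurable_b hr.measurable_U β))
          (integrable_tiltedZ_smul_resid hr β k)
        rw [hresid0 k] at h
        simpa using h.norm
      simpa using tendsto_finsetSum Finset.univ fun k _ => hk k
    have h2 := ((tendsto_sampleMean hs.iIndepFun_obs hs.identDistrib_obs
      (measurable_envelope hr.measurable_b hr.measurable_U ρ) henv).const_mul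
        (((L : ℝ) + 1) ^ 2 * (1 + ∑ k, ‖β k‖) * (48 / ρ ^ 3))).mul hdist
    have h3 := (((tendsto_missOdds hs).abs.mul (h1.add h2))).mul_const K
    simpa using h3
  have hprod := boundedInProb_calScore_zero hs hr hbal G hGlim
  have hsmall : ∀ᶠ x : ℕ × Ω in inProb P, ((L : ℝ) + 1) * ‖lamHat x.1 x.2 - lam‖ < ρ / 2 := by
    have h := hdist.const_mul ((L : ℝ) + 1)
    rw [mul_zero] at h
    exact h.eventually_lt_const (half_pos hρ)
  refine squeeze_zero_norm' ?_ hprod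
  filter_upwards [hcal, hsmall] with x hx hxs
  have hbound := norm_estFun_sub_linTerm_le hs U lam β hρ hx.1 hxs.le
  have hE : 0 ≤ sampleMean (obs X Y δ) (envelope b U lam ρ) x := by
    refine mul_nonneg (by positivity) (Finset.sum_nonneg fun i _ => ?_)
    exact mul_nonneg (mul_nonneg (hs.nonneg i _) (expTilt_pos _ _ _).le) (by positivity)
  rw [norm_smul, Real.norm_of_nonneg (Real.sqrt_nonneg _)]
  refine (mul_le_mul_of_nonneg_left (hbound.trans
    (mul_le_mul_of_nonneg_left hx.2 ?_)) (Real.sqrt_nonneg _)).trans_eq ?_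
  · have hβ0 : 0 ≤ ∑ k, ‖β k‖ := Finset.sum_nonneg fun k _ => norm_nonneg _
    have hS : 0 ≤ ∑ k, ‖sampleMean (obs X Y δ)
      (fun w => tiltedZ b lam k w • resid b U β w) x‖ := Finset.sum_nonneg fun k _ => norm_nonneg _
    positivity
  · simp only [hG]
    ring

end Expansion

/-! ### Two identities for conditional expectations -/

section ConditionalExpectation

variable {Ω E : Type*} {m m₀ : MeasurableSpace Ω} {P : Measure Ω} [IsProbabilityMeasure P]
  [NormedAddCommGroup E] [NormedSpace ℝ E] [CompleteSpace E]

/-- An integrable factor may be replaced by its conditional expectation when it is integrated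
against something that is measurable for the conditioning σ-algebra. -/
theorem integral_condExp_smul (hm : m ≤ m₀) {d : Ω → ℝ} {g : Ω → E} (hg : StronglyMeasurable[m] g)
    (hd : Integrable d P) (hdg : Integrable (fun ω => d ω • g ω) P) :
    Integrable (fun ω => P[d | m] ω • g ω) P ∧
      ∫ ω, d ω • g ω ∂P = ∫ ω, P[d | m] ω • g ω ∂P := by
  have h : P[fun ω => d ω • g ω | m] =ᵐ[P] fun ω => P[d | m] ω • g ω :=
    condExp_smul_of_aestronglyMeasurable_right hd hdg hg.aestronglyMeasurable
  exact ⟨integrable_condExp.congr h, by rw [← integral_congr_ae h, integral_condExp hm]⟩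

theorem integral_smul_eq_zero_of_condExp_eq_zero (hm : m ≤ m₀) {h : Ω → ℝ} {R : Ω → E}
    (hh : StronglyMeasurable[m] h) (hR : Integrable R P) (hhR : Integrable (fun ω => h ω • R ω) P)
    (h0 : P[R | m] =ᵐ[P] 0) : ∫ ω, h ω • R ω ∂P = 0 := by
  have hpull : P[fun ω => h ω • R ω | m] =ᵐ[P] fun ω => h ω • P[R | m] ω :=
    condExp_smul_of_aestronglyMeasurable_left hh.aestronglyMeasurable hhR hR
  rw [← integral_condExp hm, integral_congr_ae hpull]
  refine integral_eq_zero_of_ae ?_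
  filter_upwards [h0] with ω hω
  simp [hω]

end ConditionalExpectation

/-! ### Population calibration under each of the models -/

section Models

variable {Ω 𝒳 𝒴 : Type*} {L q : ℕ} [MeasurableSpace Ω] [MeasurableSpace 𝒳] [MeasurableSpace 𝒴]
  {P : Measure Ω} {X : ℕ → Ω → 𝒳} {Y : ℕ → Ω → 𝒴}
  {δ : ℕ → Ω → ℝ} {b : 𝒳 → Fin L → ℝ} {U : 𝒳 → 𝒴 → EuclideanSpace ℝ (Fin q)}
  {lam : Fin (L + 1) → ℝ}

theorem measurableSet_delta_eq (hs : IsIIDSample P X Y δ) (j : ℝ) :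
    MeasurableSet {ω | δ 0 ω = j} := hs.measurable_δ 0 (measurableSet_singleton j)

theorem measure_delta_one_ne_zero (hs : IsIIDSample P X Y δ) : P {ω | δ 0 ω = 1} ≠ 0 := fun h => by
  have := hs.prob_pos
  simp [Measure.real, h] at this

theorem indicator_delta_one (hs : IsIIDSample P X Y δ) (g : Ω → ℝ) :
    Set.indicator {ω | δ 0 ω = 1} g = fun ω => δ 0 ω * g ω := by
  ext ω
  rcases hs.binary 0 ω with h | h <;> simp [h]

theorem indicator_delta_zero (hs : IsIIDSample P X Y δ) (g : Ω → ℝ) :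
    Set.indicator {ω | δ 0 ω = 0} g = fun ω => (1 - δ 0 ω) * g ω := by
  ext ω
  rcases hs.binary 0 ω with h | h <;> simp [h]

theorem one_div_sub_one_eq_odds (hs : IsIIDSample P X Y δ) :
    1 / P.real {ω | δ 0 ω = 1} - 1 =
      (1 - P.real {ω | δ 0 ω = 1}) / P.real {ω | δ 0 ω = 1} := by
  have := hs.prob_pos
  field_simp

/-- Under the selection model the propensity `π` satisfies `π + κ exp(zᵀ λ) π = 1` with
`κ = (1 - p) / p`. -/
theorem SelectionModel.propensity (hs : IsIIDSample P X Y δ) (h : SelectionModel P X δ b lam) :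
    ∀ᵐ ω ∂P, P[δ 0 | MeasurableSpace.comap (X 0) inferInstance] ω +
      (1 - P.real {ω | δ 0 ω = 1}) / P.real {ω | δ 0 ω = 1} * expTilt b lam (X 0 ω) *
        P[δ 0 | MeasurableSpace.comap (X 0) inferInstance] ω = 1 := by
  filter_upwards [h] with ω hω
  rw [hω, one_div_sub_one_eq_odds hs]
  have h1 := mul_pos (odds_pos hs) (expTilt_pos b lam (X 0 ω))
  generalize (1 - P.real {ω | δ 0 ω = 1}) / P.real {ω | δ 0 ω = 1} = κ at h1 ⊢
  rw [mul_one_div, ← add_div, div_self (by positivity)]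

variable [IsProbabilityMeasure P]

theorem real_delta_eq_zero (hs : IsIIDSample P X Y δ) :
    P.real {ω | δ 0 ω = 0} = 1 - P.real {ω | δ 0 ω = 1} := by
  rw [← probReal_compl_eq_one_sub (measurableSet_delta_eq hs 1)]
  congr 1
  ext ω
  rcases hs.binary 0 ω with h | h <;> simp [h]

theorem measure_delta_zero_ne_zero (hs : IsIIDSample P X Y δ) : P {ω | δ 0 ω = 0} ≠ 0 := fun h => by
  have h1 := real_delta_eq_zero hs
  have h2 := hs.prob_lt_one
  rw [Measure.real, h] at h1
  simp at h1
  linarith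

theorem isProbabilityMeasure_condLaw (hs : IsIIDSample P X Y δ) {j : ℝ}
    (hj : P {ω | δ 0 ω = j} ≠ 0) : IsProbabilityMeasure (condLaw P X δ j) := by
  have := cond_isProbabilityMeasure hj
  exact Measure.isProbabilityMeasure_map (hs.measurable_X 0).aemeasurable

theorem integrable_condLaw_iff (hs : IsIIDSample P X Y δ) {j : ℝ}
    (hj : P {ω | δ 0 ω = j} ≠ 0) {f : 𝒳 → ℝ} (hf : Measurable f) :
    Integrable f (condLaw P X δ j) ↔ IntegrableOn (fun ω => f (X 0 ω)) {ω | δ 0 ω = j} P := by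
  rw [condLaw, integrable_map_measure hf.aestronglyMeasurable (hs.measurable_X 0).aemeasurable,
    ProbabilityTheory.cond, integrable_smul_measure (by simp) (by simpa using hj)]
  rfl

theorem integral_condLaw (hs : IsIIDSample P X Y δ) {j : ℝ}
    (hj : P {ω | δ 0 ω = j} ≠ 0) {f : 𝒳 → ℝ} (hf : Measurable f) :
    P.real {ω | δ 0 ω = j} * ∫ x, f x ∂(condLaw P X δ j) =
      ∫ ω in {ω | δ 0 ω = j}, f (X 0 ω) ∂P := by
  have hj' : P.real {ω | δ 0 ω = j} ≠ 0 := by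
    simp [Measure.real, ENNReal.toReal_eq_zero_iff, hj]
  rw [condLaw, integral_map (hs.measurable_X 0).aemeasurable hf.aestronglyMeasurable,
    ProbabilityTheory.cond, integral_smul_measure, ENNReal.toReal_inv, smul_eq_mul,
    ← Measure.real, mul_inv_cancel_left₀ hj']

theorem integral_condLaw_one (hs : IsIIDSample P X Y δ) {f : 𝒳 → ℝ} (hf : Measurable f) :
    P.real {ω | δ 0 ω = 1} * ∫ x, f x ∂(condLaw P X δ 1) = ∫ ω, δ 0 ω * f (X 0 ω) ∂P := by
  rw [integral_condLaw hs (measure_delta_one_ne_zero hs) hf,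
    ← integral_indicator (measurableSet_delta_eq hs 1), indicator_delta_one hs]

theorem integral_condLaw_zero (hs : IsIIDSample P X Y δ) {f : 𝒳 → ℝ} (hf : Measurable f) :
    (1 - P.real {ω | δ 0 ω = 1}) * ∫ x, f x ∂(condLaw P X δ 0) =
      ∫ ω, (1 - δ 0 ω) * f (X 0 ω) ∂P := by
  rw [← real_delta_eq_zero hs, integral_condLaw hs (measure_delta_zero_ne_zero hs) hf,
    ← integral_indicator (measurableSet_delta_eq hs 0), indicator_delta_zero hs]

theorem integrable_condLaw_one_iff (hs : IsIIDSample P X Y δ) {f : 𝒳 → ℝ} (hf : Measurable f) :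
    Integrable f (condLaw P X δ 1) ↔ Integrable (fun ω => δ 0 ω * f (X 0 ω)) P := by
  rw [integrable_condLaw_iff hs (measure_delta_one_ne_zero hs) hf,
    ← integrable_indicator_iff (measurableSet_delta_eq hs 1), indicator_delta_one hs]

theorem integrable_condLaw_zero_iff (hs : IsIIDSample P X Y δ) {f : 𝒳 → ℝ} (hf : Measurable f) :
    Integrable f (condLaw P X δ 0) ↔ Integrable (fun ω => (1 - δ 0 ω) * f (X 0 ω)) P := by
  rw [integrable_condLaw_iff hs (measure_delta_zero_ne_zero hs) hf,
    ← integrable_indicator_iff (measurableSet_delta_eq hs 0), indicator_delta_zero hs]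

theorem integrable_delta_mul_zvec (hs : IsIIDSample P X Y δ) (hr : Regularity P X Y δ b U lam)
    (k : Fin (L + 1)) : Integrable (fun ω => δ 0 ω * zvec b (X 0 ω) k) P :=
  ((memLp_zvec hr k).integrable (by norm_num)).bdd_mul
    (hs.measurable_δ 0).aestronglyMeasurable (ae_of_all _ (hs.abs_le_one 0))

/-- The smoothed ratio integrates functions of `b` under `f₁` as the ratio itself does, which
turns `f₁`-moments of `z` tilted by it into `f₀`-moments. -/
theorem LogLinearModel.balanced (hs : IsIIDSample P X Y δ) (hr : Regularity P X Y δ b U lam)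
    (h : LogLinearModel P X δ b lam) : Balanced P X Y δ b lam := by
  intro k
  have hp := hs.prob_pos
  have := isProbabilityMeasure_condLaw hs (measure_delta_one_ne_zero hs)
  have := isProbabilityMeasure_condLaw hs (measure_delta_zero_ne_zero hs)
  have hz := measurable_zvec_apply hr.measurable_b k
  have hzb : Measurable[MeasurableSpace.comap b inferInstance] fun x => zvec b x k :=
    (measurable_zvec_apply measurable_id k).comp (comap_measurable b)
  have hint0 : Integrable (fun x => zvec b x k) (condLaw P X δ 0) :=
    (integrable_condLaw_zero_iff hs hz).2 ((memLp_missingZ hs hr k).integrable (by norm_num))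
  have hrz : Integrable (fun x => densityRatio P X δ x • zvec b x k) (condLaw P X δ 1) :=
    (integrable_rnDeriv_smul_iff h.absCont).2 hint0
  have key : ∫ x, expTilt b lam x * zvec b x k ∂(condLaw P X δ 1) =
      ∫ x, zvec b x k ∂(condLaw P X δ 0) := by
    have h1 := (integral_condExp_smul hr.measurable_b.comap_le hzb.stronglyMeasurable
      Measure.integrable_toReal_rnDeriv hrz).2
    rw [← integral_rnDeriv_smul h.absCont]
    refine Eq.trans (integral_congr_ae ?_) h1.symm
    filter_upwards [h.ratio_eq] with x hx
    rw [← hx]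
    rfl
  have h1 := integral_condLaw_one hs ((measurable_expTilt hr.measurable_b lam).mul hz)
  have h0 := integral_condLaw_zero hs hz
  have e1 : ∫ ω, tiltedZ b lam k (obs X Y δ 0 ω) ∂P =
      ∫ ω, δ 0 ω * (expTilt b lam (X 0 ω) * zvec b (X 0 ω) k) ∂P :=
    integral_congr_ae (ae_of_all _ fun ω => by simp only [tiltedZ, obs]; ring)
  rw [e1]
  refine Eq.trans ?_ h0
  rw [← key]
  simp only [Pi.mul_apply] at h1
  rw [← h1]
  field_simp

theorem IsProjection.balanced (hs : IsIIDSample P X Y δ) (hr : Regularity P X Y δ b U lam)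
    (h : IsProjection P X δ b lam) : Balanced P X Y δ b lam := by
  intro k
  have hp := hs.prob_pos
  have he := measurable_expTilt hr.measurable_b lam
  set p := P.real {ω | δ 0 ω = 1} with hpdef
  have hz := measurable_zvec_apply hr.measurable_b k
  have h1 := integral_condLaw_one hs (he.mul hz)
  simp only [Pi.mul_apply] at h1
  have e1 : ∫ ω, tiltedZ b lam k (obs X Y δ 0 ω) ∂P =
      ∫ ω, δ 0 ω * (expTilt b lam (X 0 ω) * zvec b (X 0 ω) k) ∂P :=
    integral_congr_ae (ae_of_all _ fun ω => by simp only [tiltedZ, obs]; ring)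
  have hδz := integrable_delta_mul_zvec hs hr k
  have e0 : ∫ ω, missingZ b k (obs X Y δ 0 ω) ∂P =
      ∫ ω, zvec b (X 0 ω) k ∂P - ∫ ω, δ 0 ω * zvec b (X 0 ω) k ∂P := by
    rw [← integral_sub ((memLp_zvec hr k).integrable (by norm_num)) hδz]
    exact integral_congr_ae (ae_of_all _ fun ω => by simp only [missingZ, obs]; ring)
  rw [e1, ← h1, e0]
  revert h1 e1 hδz e0 hz
  refine Fin.cases ?_ (fun l => ?_) k
  · intro _ _ _ _ _
    simp only [zvec_zero, mul_one, h.normalized, integral_delta hs]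
    simp only [integral_const, probReal_univ, smul_eq_mul, mul_one]
    rw [← hpdef]
    field_simp
  · intro hz _ _ hδz _
    have hm := h.moment l
    have hi1 : Integrable (fun x => b x l) (condLaw P X δ 1) :=
      (integrable_condLaw_one_iff hs hz).2 hδz
    have hi2 : Integrable (fun x => expTilt b lam x * b x l) (condLaw P X δ 1) := by
      refine (integrable_condLaw_one_iff hs (he.mul hz)).2 ?_
      refine ((memLp_tiltedZ hr l.succ).integrable (by norm_num)).congr (ae_of_all _ fun ω => ?_)
      simp only [tiltedZ, obs, Pi.mul_apply]; ring
    have e : ∫ x, b x l * (1 + (1 - p) / p * expTilt b lam x) ∂(condLaw P X δ 1) =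
        ∫ x, b x l ∂(condLaw P X δ 1) +
          (1 - p) / p * ∫ x, expTilt b lam x * b x l ∂(condLaw P X δ 1) := by
      rw [← integral_const_mul, ← integral_add hi1 (hi2.const_mul _)]
      exact integral_congr_ae (ae_of_all _ fun x => by simp only; ring)
    have h2 := integral_condLaw_one hs hz
    simp only [zvec_succ] at h2 ⊢
    rw [← hpdef] at hm h2
    rw [e] at hm
    rw [← h2, ← hm]
    ring

theorem SelectionModel.balanced (hs : IsIIDSample P X Y δ) (hr : Regularity P X Y δ b U lam)
    (h : SelectionModel P X δ b lam) : Balanced P X Y δ b lam := by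
  intro k
  have hle : MeasurableSpace.comap (X 0) inferInstance ≤ (inferInstance : MeasurableSpace Ω) :=
    (hs.measurable_X 0).comap_le
  have hz := measurable_zvec_apply hr.measurable_b k
  have he := measurable_expTilt hr.measurable_b lam
  have hzX : StronglyMeasurable[MeasurableSpace.comap (X 0) inferInstance]
      fun ω => zvec b (X 0 ω) k := (hz.comp (comap_measurable (X 0))).stronglyMeasurable
  have hezX : StronglyMeasurable[MeasurableSpace.comap (X 0) inferInstance]
      fun ω => expTilt b lam (X 0 ω) * zvec b (X 0 ω) k :=
    ((he.mul hz).comp (comap_measurable (X 0))).stronglyMeasurable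
  have hδ := integrable_delta hs 0
  have hint : Integrable (fun ω => zvec b (X 0 ω) k) P :=
    (memLp_zvec hr k).integrable (by norm_num)
  have hδz : Integrable (fun ω => δ 0 ω • zvec b (X 0 ω) k) P := integrable_delta_mul_zvec hs hr k
  have e1 : (fun ω => tiltedZ b lam k (obs X Y δ 0 ω)) =
      fun ω => δ 0 ω • (expTilt b lam (X 0 ω) * zvec b (X 0 ω) k) := by
    ext ω; simp only [tiltedZ, obs, smul_eq_mul]; ring
  have hez : Integrable (fun ω => δ 0 ω • (expTilt b lam (X 0 ω) * zvec b (X 0 ω) k)) P :=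
    e1 ▸ (memLp_tiltedZ hr k).integrable (by norm_num)
  have e0 : ∫ ω, missingZ b k (obs X Y δ 0 ω) ∂P =
      ∫ ω, zvec b (X 0 ω) k ∂P - ∫ ω, δ 0 ω • zvec b (X 0 ω) k ∂P := by
    rw [← integral_sub hint hδz]
    exact integral_congr_ae (ae_of_all _ fun ω => by
      simp only [missingZ, obs, smul_eq_mul]; ring)
  obtain ⟨hi1, hI1⟩ := integral_condExp_smul hle hezX hδ hez
  obtain ⟨hi2, hI2⟩ := integral_condExp_smul hle hzX hδ hδz
  rw [e0, e1, hI1, hI2, ← integral_sub hint hi2, ← integral_const_mul]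
  refine integral_congr_ae ?_
  filter_upwards [h.propensity hs] with ω hω
  simp only [smul_eq_mul]
  linear_combination (zvec b (X 0 ω) k) * hω

end Models

/-! ### Unbiasedness of the leading term and consistency -/

section Unbiasedness

variable {Ω 𝒳 𝒴 : Type*} {L q : ℕ}

/-- The fluctuating odds `N₀ / N₁` separate from the part of the linear term that does not depend
on them. -/
theorem linTerm_eq (X : ℕ → Ω → 𝒳) (Y : ℕ → Ω → 𝒴) (δ : ℕ → Ω → ℝ) (b : 𝒳 → Fin L → ℝ)
    (U : 𝒳 → 𝒴 → EuclideanSpace ℝ (Fin q)) (lam : Fin (L + 1) → ℝ)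
    (β : Fin (L + 1) → EuclideanSpace ℝ (Fin q)) (N : ℕ) (ω : Ω) :
    linTerm X Y δ b U lam β N ω =
      sampleMean (obs X Y δ) (fun w => linPred b β w.1 + w.2.2 • resid b U β w) (N, ω) +
      missOdds δ (N, ω) •
        sampleMean (obs X Y δ) (fun w => tiltedZ b lam 0 w • resid b U β w) (N, ω) := by
  simp only [linTerm, sampleMean]
  rw [smul_comm (missOdds δ (N, ω)), ← smul_add]
  congr 1
  rw [Finset.smul_sum, ← Finset.sum_add_distrib]
  refine Finset.sum_congr rfl fun i _ => ?_
  have hw : δ i ω * weight δ b N ω lam (X i ω) = δ i ω +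
      missOdds δ (N, ω) * (δ i ω * expTilt b lam (X i ω)) := by
    simp only [weight, missOdds]
    ring
  simp only [hw, resid, obs, tiltedZ, zvec_zero, mul_one]
  module

theorem integral_tiltedZ_smul_resid_eq [MeasurableSpace Ω] (P : Measure Ω)
    (X : ℕ → Ω → 𝒳) (Y : ℕ → Ω → 𝒴) (δ : ℕ → Ω → ℝ) (b : 𝒳 → Fin L → ℝ)
    (U : 𝒳 → 𝒴 → EuclideanSpace ℝ (Fin q)) (lam : Fin (L + 1) → ℝ)
    (β : Fin (L + 1) → EuclideanSpace ℝ (Fin q)) (k : Fin (L + 1)) :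
    ∫ ω, tiltedZ b lam k (obs X Y δ 0 ω) • resid b U β (obs X Y δ 0 ω) ∂P =
      ∫ ω, δ 0 ω • (expTilt b lam (X 0 ω) * zvec b (X 0 ω) k) •
        (U (X 0 ω) (Y 0 ω) - linPred b β (X 0 ω)) ∂P :=
  integral_congr_ae (ae_of_all _ fun ω => by
    simp only [tiltedZ, resid, obs, smul_smul, mul_assoc])

variable [MeasurableSpace Ω] [MeasurableSpace 𝒳] [MeasurableSpace 𝒴]
  {P : Measure Ω} {X : ℕ → Ω → 𝒳} {Y : ℕ → Ω → 𝒴}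
  {δ : ℕ → Ω → ℝ} {b : 𝒳 → Fin L → ℝ} {U : 𝒳 → 𝒴 → EuclideanSpace ℝ (Fin q)}
  {lam : Fin (L + 1) → ℝ}

/-- On the event that unit `i` responds, the odds are a function of the other units only. -/
theorem missOdds_mul_delta (hs : IsIIDSample P X Y δ) {N i : ℕ} (hi : i ∈ Finset.range N) (ω : Ω) :
    missOdds δ (N, ω) * δ i ω = ((N : ℝ) - 1 - ∑ j ∈ (Finset.range N).erase i, δ j ω) /
      (1 + ∑ j ∈ (Finset.range N).erase i, δ j ω) * δ i ω := by
  have hsum : numObs δ N ω = δ i ω + ∑ j ∈ (Finset.range N).erase i, δ j ω :=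
    (Finset.add_sum_erase _ _ hi).symm
  rcases hs.binary i ω with h | h
  · simp [h]
  · simp only [missOdds, numMis, hsum, h]
    ring

/-- A mean-zero function `h` of the data of one unit that vanishes for nonrespondents stays
mean-zero after multiplication with the sample odds: where `h` is nonzero, the odds agree with a
function of the other units, which is independent of `h`. -/
theorem integral_missOdds_smul [IsProbabilityMeasure P] (hs : IsIIDSample P X Y δ)
    {E : Type*} [NormedAddCommGroup E] [NormedSpace ℝ E] [CompleteSpace E] [MeasurableSpace E]
    [BorelSpace E] [SecondCountableTopology E] {h g : 𝒳 × 𝒴 × ℝ → E} (hh : Measurable h)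
    (hint : Integrable (fun ω => h (obs X Y δ 0 ω)) P) (h0 : ∫ ω, h (obs X Y δ 0 ω) ∂P = 0)
    (hsupp : ∀ w, h w = w.2.2 • g w)
    {N i : ℕ} (hi : i ∈ Finset.range N) :
    Integrable (fun ω => missOdds δ (N, ω) • h (obs X Y δ i ω)) P ∧
      ∫ ω, missOdds δ (N, ω) • h (obs X Y δ i ω) ∂P = 0 := by
  set S : Ω → ℝ := fun ω => ∑ j ∈ (Finset.range N).erase i, δ j ω with hS
  set φ : ℝ → ℝ := fun s => ((N : ℝ) - 1 - s) / (1 + s) with hφ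
  have hφm : Measurable φ := by
    simp only [hφ]; fun_prop
  have hSm : Measurable S := Finset.measurable_sum _ fun j _ => hs.measurable_δ j
  have hS0 : ∀ ω, 0 ≤ S ω := fun ω => Finset.sum_nonneg fun j _ => hs.nonneg j ω
  have heq : (fun ω => missOdds δ (N, ω) • h (obs X Y δ i ω)) =
      fun ω => φ (S ω) • h (obs X Y δ i ω) := by
    ext1 ω
    rw [hsupp, smul_smul, smul_smul]
    exact congrArg (· • g (obs X Y δ i ω)) (missOdds_mul_delta hs hi ω)
  have hid : IdentDistrib (fun ω => h (obs X Y δ i ω)) (fun ω => h (obs X Y δ 0 ω)) P P :=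
    (hs.identDistrib_obs i).comp hh
  have hinti : Integrable (fun ω => h (obs X Y δ i ω)) P := hid.integrable_iff.2 hint
  -- `|N - 1 - s| ≤ N (1 + s)` for `s ≥ 0`, so the replaced odds are bounded
  have hbound : ∀ ω, ‖φ (S ω)‖ ≤ N := by
    intro ω
    have hN : (1 : ℝ) ≤ N := by
      exact_mod_cast (Nat.zero_le i).trans_lt (Finset.mem_range.1 hi)
    have hSω := hS0 ω
    rw [Real.norm_eq_abs, abs_div, abs_of_pos (by linarith : 0 < 1 + S ω),
      div_le_iff₀ (by linarith), abs_le]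
    constructor <;> nlinarith
  rw [heq]
  refine ⟨hinti.bdd_smul (N : ℝ) (hφm.comp hSm).aestronglyMeasurable (ae_of_all _ hbound), ?_⟩
  have hindep : IndepFun S (obs X Y δ i) P := by
    have hI := hs.iIndepFun_obs.indepFun_finset ((Finset.range N).erase i) {i}
      (by simp) hs.measurable_obs
    have h1 : Measurable fun v : ((Finset.range N).erase i : Finset ℕ) → 𝒳 × 𝒴 × ℝ =>
        ∑ j, (v j).2.2 :=
      Finset.measurable_sum _ fun j _ => (measurable_pi_apply j).snd.snd
    have h2 : Measurable fun v : ({i} : Finset ℕ) → 𝒳 × 𝒴 × ℝ =>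
        v ⟨i, Finset.mem_singleton_self i⟩ := measurable_pi_apply _
    have hI' := hI.comp h1 h2
    refine hI'.congr (ae_of_all _ fun ω => ?_) (ae_of_all _ fun ω => rfl)
    exact Finset.sum_coe_sort ((Finset.range N).erase i) fun j => δ j ω
  rw [hindep.integral_fun_comp_smul_comp hSm.aemeasurable (hs.measurable_obs i).aemeasurable
    hφm.aestronglyMeasurable hh.aestronglyMeasurable, hid.integral_eq, h0, smul_zero]

/-- The residual as a function of `(x, y)`. -/
theorem measurable_resid_pair (hr : Regularity P X Y δ b U lam)
    (β : Fin (L + 1) → EuclideanSpace ℝ (Fin q)) :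
    Measurable fun v : 𝒳 × 𝒴 => U v.1 v.2 - linPred b β v.1 :=
  hr.measurable_U.sub ((measurable_linPred hr.measurable_b β).comp measurable_fst)

theorem measurable_tilt_resid_pair (hr : Regularity P X Y δ b U lam)
    (β : Fin (L + 1) → EuclideanSpace ℝ (Fin q)) (k : Fin (L + 1)) :
    Measurable fun v : 𝒳 × 𝒴 =>
      (expTilt b lam v.1 * zvec b v.1 k) • (U v.1 v.2 - linPred b β v.1) :=
  (((measurable_expTilt hr.measurable_b lam).mul
    (measurable_zvec_apply hr.measurable_b k)).comp measurable_fst).smul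
      (measurable_resid_pair hr β)

theorem measurable_leading (hb : Measurable b) (hU : Measurable (Function.uncurry U))
    (β : Fin (L + 1) → EuclideanSpace ℝ (Fin q)) :
    Measurable fun w : 𝒳 × 𝒴 × ℝ => linPred b β w.1 + w.2.2 • resid b U β w :=
  ((measurable_linPred hb β).comp measurable_fst).add
    (measurable_snd.snd.smul (measurable_resid hb hU β))

variable [IsProbabilityMeasure P]

theorem integrable_delta_smul_resid (hs : IsIIDSample P X Y δ) (hr : Regularity P X Y δ b U lam)
    (β : Fin (L + 1) → EuclideanSpace ℝ (Fin q)) :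
    Integrable (fun ω => δ 0 ω • resid b U β (obs X Y δ 0 ω)) P :=
  (integrable_resid hr β).bdd_smul 1 (hs.measurable_δ 0).aestronglyMeasurable
    (ae_of_all _ (hs.abs_le_one 0))

/-- The linear term is unbiased, and the estimating function consistent, for
`E{zᵀ β + δ (U - zᵀ β)}`. -/
theorem isUnbiased_of_integral_eq (hs : IsIIDSample P X Y δ) (hr : Regularity P X Y δ b U lam)
    (hexp : Expansion P X Y δ b U lam (popBeta P X Y δ b U lam))
    (hmean : ∫ ω, δ 0 ω • resid b U (popBeta P X Y δ b U lam) (obs X Y δ 0 ω) ∂P =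
      ∫ ω, resid b U (popBeta P X Y δ b U lam) (obs X Y δ 0 ω) ∂P) :
    IsUnbiased P X Y δ b U lam (popBeta P X Y δ b U lam) := by
  set β := popBeta P X Y δ b U lam with hβ
  have hres0 := (eq_popBeta_iff hr β).1 hβ 0
  set lead : 𝒳 × 𝒴 × ℝ → EuclideanSpace ℝ (Fin q) :=
    fun w => linPred b β w.1 + w.2.2 • resid b U β w with hlead
  set score : 𝒳 × 𝒴 × ℝ → EuclideanSpace ℝ (Fin q) :=
    fun w => tiltedZ b lam 0 w • resid b U β w with hscore
  have hleadm : Measurable lead := measurable_leading hr.measurable_b hr.measurable_U β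
  have hscorem : Measurable score := (measurable_tiltedZ hr.measurable_b 0).smul
    (measurable_resid hr.measurable_b hr.measurable_U β)
  have hscorei : Integrable (fun ω => score (obs X Y δ 0 ω)) P :=
    integrable_tiltedZ_smul_resid hr β 0
  have hleadi : Integrable (fun ω => lead (obs X Y δ 0 ω)) P :=
    (integrable_linPred hr β).add (integrable_delta_smul_resid hs hr β)
  have hleadI : ∫ ω, lead (obs X Y δ 0 ω) ∂P = ∫ ω, U (X 0 ω) (Y 0 ω) ∂P := by
    have h1 : ∫ ω, lead (obs X Y δ 0 ω) ∂P = ∫ ω, linPred b β (X 0 ω) ∂P +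
        ∫ ω, δ 0 ω • resid b U β (obs X Y δ 0 ω) ∂P :=
      integral_add (integrable_linPred hr β) (integrable_delta_smul_resid hs hr β)
    have h2 : ∫ ω, resid b U β (obs X Y δ 0 ω) ∂P =
        ∫ ω, U (X 0 ω) (Y 0 ω) ∂P - ∫ ω, linPred b β (X 0 ω) ∂P :=
      integral_sub (integrable_U hr) (integrable_linPred hr β)
    rw [h1, hmean, h2]
    abel
  have hsupp : ∀ w, score w = w.2.2 • ((expTilt b lam w.1 * zvec b w.1 0) • resid b U β w) :=
    fun w => by simp only [hscore, tiltedZ, smul_smul, mul_assoc]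
  have hodds := fun (N i : ℕ) (hi : i ∈ Finset.range N) =>
    integral_missOdds_smul hs hscorem hscorei hres0 hsupp hi
  constructor
  · intro N hN
    have hN' : (N : ℝ) ≠ 0 := by exact_mod_cast (Nat.one_le_iff_ne_zero.1 hN)
    have hform : linTerm X Y δ b U lam β N = fun ω =>
        (N : ℝ)⁻¹ • ∑ i ∈ Finset.range N,
          (lead (obs X Y δ i ω) + missOdds δ (N, ω) • score (obs X Y δ i ω)) := by
      ext1 ω
      rw [linTerm_eq, sampleMean, sampleMean, smul_comm (missOdds δ (N, ω)), ← smul_add,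
        Finset.smul_sum, ← Finset.sum_add_distrib]
    have hid : ∀ i, IdentDistrib (fun ω => lead (obs X Y δ i ω))
        (fun ω => lead (obs X Y δ 0 ω)) P P := fun i => (hs.identDistrib_obs i).comp hleadm
    have hi : ∀ i ∈ Finset.range N, Integrable (fun ω =>
        lead (obs X Y δ i ω) + missOdds δ (N, ω) • score (obs X Y δ i ω)) P := fun i hi =>
      ((hid i).integrable_iff.2 hleadi).add (hodds N i hi).1
    rw [hform]
    refine ⟨(integrable_finsetSum _ hi).smul (N : ℝ)⁻¹, ?_⟩
    rw [integral_smul, integral_finsetSum _ hi]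
    have hterm : ∀ i ∈ Finset.range N, ∫ ω, (lead (obs X Y δ i ω) +
        missOdds δ (N, ω) • score (obs X Y δ i ω)) ∂P = ∫ ω, U (X 0 ω) (Y 0 ω) ∂P := by
      intro i hi
      rw [integral_add ((hid i).integrable_iff.2 hleadi) (hodds N i hi).1, (hodds N i hi).2,
        add_zero, (hid i).integral_eq, hleadI]
    rw [Finset.sum_congr rfl hterm, Finset.sum_const, Finset.card_range, ← Nat.cast_smul_eq_nsmul ℝ,
      smul_smul, inv_mul_cancel₀ hN', one_smul]
  · intro lamHat hlam
    have h1 := (hexp.2 lamHat hlam).2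
    rw [tendstoInMeasure_const_iff] at h1 ⊢
    have hlin : Tendsto (fun x : ℕ × Ω => linTerm X Y δ b U lam β x.1 x.2) (inProb P)
        (𝓝 (∫ ω, U (X 0 ω) (Y 0 ω) ∂P)) := by
      have h2 := (tendsto_sampleMean hs.iIndepFun_obs hs.identDistrib_obs hleadm hleadi).add
        ((tendsto_missOdds hs).smul
          (tendsto_sampleMean hs.iIndepFun_obs hs.identDistrib_obs hscorem hscorei))
      rw [hres0, smul_zero, add_zero, hleadI] at h2
      exact h2.congr fun x => (linTerm_eq X Y δ b U lam β x.1 x.2).symm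
    have hdiff : Tendsto (fun x : ℕ × Ω => estFun X Y δ b U x.1 x.2 (lamHat x.1 x.2) -
        linTerm X Y δ b U lam β x.1 x.2) (inProb P) (𝓝 0) := by
      refine squeeze_zero_norm' ?_ (by simpa using h1.norm)
      filter_upwards [tendsto_fst_inProb.eventually_ge_atTop 1] with x hN
      have hsqrt : 1 ≤ √(x.1 : ℝ) := Real.one_le_sqrt.2 (by exact_mod_cast hN)
      rw [norm_smul, Real.norm_of_nonneg (Real.sqrt_nonneg _)]
      exact le_mul_of_one_le_left (norm_nonneg _) hsqrt
    simpa using hdiff.add hlin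

/-- Under missingness at random, `δ` may be replaced by the propensity `P(δ = 1 | X)` when it is
integrated against a function of `(X, Y)`. -/
theorem MissingAtRandom.integral_smul (hs : IsIIDSample P X Y δ) (hmar : MissingAtRandom P X Y δ)
    {G : 𝒳 × 𝒴 → EuclideanSpace ℝ (Fin q)} (hG : Measurable G)
    (hint : Integrable (fun ω => δ 0 ω • G (X 0 ω, Y 0 ω)) P) :
    Integrable (fun ω => P[δ 0 | MeasurableSpace.comap (X 0) inferInstance] ω •
      G (X 0 ω, Y 0 ω)) P ∧
    ∫ ω, δ 0 ω • G (X 0 ω, Y 0 ω) ∂P =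
      ∫ ω, P[δ 0 | MeasurableSpace.comap (X 0) inferInstance] ω • G (X 0 ω, Y 0 ω) ∂P := by
  have hXY : Measurable fun ω => (X 0 ω, Y 0 ω) := (hs.measurable_X 0).prodMk (hs.measurable_Y 0)
  have hGm : StronglyMeasurable[MeasurableSpace.comap (fun ω => (X 0 ω, Y 0 ω)) inferInstance]
      fun ω => G (X 0 ω, Y 0 ω) :=
    (hG.comp (comap_measurable fun ω => (X 0 ω, Y 0 ω))).stronglyMeasurable
  obtain ⟨hi, hI⟩ := integral_condExp_smul hXY.comap_le hGm (integrable_delta hs 0) hint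
  have hae : (fun ω => P[δ 0 | MeasurableSpace.comap (fun ω => (X 0 ω, Y 0 ω)) inferInstance] ω •
      G (X 0 ω, Y 0 ω)) =ᵐ[P] fun ω =>
        P[δ 0 | MeasurableSpace.comap (X 0) inferInstance] ω • G (X 0 ω, Y 0 ω) := by
    filter_upwards [hmar] with ω hω
    rw [hω]
  exact ⟨hi.congr hae, hI.trans (integral_congr_ae hae)⟩

theorem integrable_delta_smul_tilt_resid (hr : Regularity P X Y δ b U lam)
    (β : Fin (L + 1) → EuclideanSpace ℝ (Fin q)) (k : Fin (L + 1)) :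
    Integrable (fun ω => δ 0 ω • (expTilt b lam (X 0 ω) * zvec b (X 0 ω) k) •
      (U (X 0 ω) (Y 0 ω) - linPred b β (X 0 ω))) P := by
  refine (integrable_tiltedZ_smul_resid hr β k).congr (ae_of_all _ fun ω => ?_)
  simp only [tiltedZ, resid, obs, smul_smul, mul_assoc]

/-- Inverse propensity weighting: `δ` and `δ (1 + κ exp(zᵀ λ)) = δ / π` integrate the residual to
the same value by the normal equation for the intercept, and the latter removes the selection. -/
theorem SelectionModel.integral_delta_smul_resid (hs : IsIIDSample P X Y δ)
    (hr : Regularity P X Y δ b U lam) (hmar : MissingAtRandom P X Y δ)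
    (h : SelectionModel P X δ b lam) :
    ∫ ω, δ 0 ω • resid b U (popBeta P X Y δ b U lam) (obs X Y δ 0 ω) ∂P =
      ∫ ω, resid b U (popBeta P X Y δ b U lam) (obs X Y δ 0 ω) ∂P := by
  set β := popBeta P X Y δ b U lam with hβ
  set κ := (1 - P.real {ω | δ 0 ω = 1}) / P.real {ω | δ 0 ω = 1} with hκ
  have hres0 := (eq_popBeta_iff hr β).1 hβ 0
  rw [integral_tiltedZ_smul_resid_eq] at hres0
  obtain ⟨hi1, hI1⟩ := hmar.integral_smul hs (measurable_resid_pair hr β)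
    (integrable_delta_smul_resid hs hr β)
  obtain ⟨hi2, hI2⟩ := hmar.integral_smul hs (measurable_tilt_resid_pair hr β 0)
    (integrable_delta_smul_tilt_resid hr β 0)
  rw [hI2] at hres0
  calc ∫ ω, δ 0 ω • resid b U β (obs X Y δ 0 ω) ∂P
      = ∫ ω, P[δ 0 | MeasurableSpace.comap (X 0) inferInstance] ω •
          (U (X 0 ω) (Y 0 ω) - linPred b β (X 0 ω)) ∂P +
        κ • ∫ ω, P[δ 0 | MeasurableSpace.comap (X 0) inferInstance] ω •
          (expTilt b lam (X 0 ω) * zvec b (X 0 ω) 0) •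
            (U (X 0 ω) (Y 0 ω) - linPred b β (X 0 ω)) ∂P := by
        rw [hres0, smul_zero, add_zero]
        exact hI1
    _ = ∫ ω, resid b U β (obs X Y δ 0 ω) ∂P := by
        rw [← integral_smul]
        refine (integral_add hi1 (hi2.smul κ)).symm.trans (integral_congr_ae ?_)
        filter_upwards [h.propensity hs] with ω hω
        simp only [Pi.smul_apply, smul_smul, ← add_smul, zvec_zero, mul_one, resid, obs]
        rw [show P[δ 0 | MeasurableSpace.comap (X 0) inferInstance] ω +
          κ * (P[δ 0 | MeasurableSpace.comap (X 0) inferInstance] ω * expTilt b lam (X 0 ω)) = 1 by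
            rw [← hω]; ring, one_smul]

section OutcomeRegression

variable (hs : IsIIDSample P X Y δ) (hr : Regularity P X Y δ b U lam)
  (hmar : MissingAtRandom P X Y δ) {α : Fin (L + 1) → EuclideanSpace ℝ (Fin q)}
  (hα : outcomeMean P X Y U =ᵐ[P] fun ω => linPred b α (X 0 ω))
include hs hr hα

theorem condExp_resid_eq_zero :
    P[fun ω => U (X 0 ω) (Y 0 ω) - linPred b α (X 0 ω) |
      MeasurableSpace.comap (X 0) inferInstance] =ᵐ[P] 0 := by
  have hlin : StronglyMeasurable[MeasurableSpace.comap (X 0) inferInstance]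
      fun ω => linPred b α (X 0 ω) :=
    ((measurable_linPred hr.measurable_b α).comp (comap_measurable (X 0))).stronglyMeasurable
  have hsub := condExp_sub (integrable_U hr) (integrable_linPred hr α)
    (MeasurableSpace.comap (X 0) inferInstance)
  rw [condExp_of_stronglyMeasurable (hs.measurable_X 0).comap_le hlin
    (integrable_linPred hr α)] at hsub
  filter_upwards [hsub, hα] with ω h1 h2
  refine h1.trans ?_
  rw [Pi.sub_apply, Pi.zero_apply, sub_eq_zero]
  exact h2

include hmar

/-- A correctly specified regression solves the normal equations whatever the weights are. -/
theorem eq_popBeta_of_outcomeModel : α = popBeta P X Y δ b U lam := by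
  refine (eq_popBeta_iff hr α).2 fun k => ?_
  rw [integral_tiltedZ_smul_resid_eq]
  obtain ⟨hi, hI⟩ := hmar.integral_smul hs (measurable_tilt_resid_pair hr α k)
    (integrable_delta_smul_tilt_resid hr α k)
  rw [hI]
  simp only [smul_smul] at hi ⊢
  refine integral_smul_eq_zero_of_condExp_eq_zero (hs.measurable_X 0).comap_le ?_
    (integrable_resid (δ := δ) hr α) hi (condExp_resid_eq_zero hs hr hα)
  exact stronglyMeasurable_condExp.mul ((((measurable_expTilt hr.measurable_b lam).mul
    (measurable_zvec_apply hr.measurable_b k)).comp (comap_measurable (X 0))).stronglyMeasurable)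

theorem integral_delta_smul_resid_of_outcomeModel :
    ∫ ω, δ 0 ω • resid b U α (obs X Y δ 0 ω) ∂P = ∫ ω, resid b U α (obs X Y δ 0 ω) ∂P := by
  have h0 := condExp_resid_eq_zero hs hr hα
  obtain ⟨hi, hI⟩ := hmar.integral_smul hs (measurable_resid_pair hr α)
    (integrable_delta_smul_resid hs hr α)
  have h1 : ∫ ω, resid b U α (obs X Y δ 0 ω) ∂P = 0 := by
    have h2 := integral_condExp (μ := P) (f := fun ω => U (X 0 ω) (Y 0 ω) - linPred b α (X 0 ω))
      (hs.measurable_X 0).comap_le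
    rw [integral_congr_ae h0] at h2
    exact h2.symm.trans (by simp)
  rw [h1]
  refine hI.trans ?_
  exact integral_smul_eq_zero_of_condExp_eq_zero (hs.measurable_X 0).comap_le
    stronglyMeasurable_condExp (integrable_resid (δ := δ) hr α) hi h0

end OutcomeRegression

end Unbiasedness
end SmoothedPS

theorem theorem1 {Ω 𝒳 𝒴 : Type*} [MeasurableSpace Ω] [MeasurableSpace 𝒳] [MeasurableSpace 𝒴]
    {L q : ℕ} (P : Measure Ω) [IsProbabilityMeasure P]
    (X : ℕ → Ω → 𝒳) (Y : ℕ → Ω → 𝒴) (δ : ℕ → Ω → ℝ)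
    (b : 𝒳 → Fin L → ℝ)
    (U : EuclideanSpace ℝ (Fin q) → 𝒳 → 𝒴 → EuclideanSpace ℝ (Fin q))
    (θ : EuclideanSpace ℝ (Fin q)) (lamStar : Fin (L + 1) → ℝ)
    (hsample : SmoothedPS.IsIIDSample P X Y δ)
    (hreg : SmoothedPS.Regularity P X Y δ b (U θ) lamStar) :
    ∃ βStar : Fin (L + 1) → EuclideanSpace ℝ (Fin q),
      SmoothedPS.IsWLSLimit P X Y δ b (U θ) lamStar βStar ∧
      (SmoothedPS.LogLinearModel P X δ b lamStar →
        SmoothedPS.Expansion P X Y δ b (U θ) lamStar βStar) ∧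
      (SmoothedPS.MissingAtRandom P X Y δ → SmoothedPS.SelectionModel P X δ b lamStar →
        SmoothedPS.Expansion P X Y δ b (U θ) lamStar βStar ∧
        SmoothedPS.IsUnbiased P X Y δ b (U θ) lamStar βStar) ∧
      (SmoothedPS.MissingAtRandom P X Y δ → SmoothedPS.OutcomeModel P X Y b (U θ) →
        SmoothedPS.IsProjection P X δ b lamStar →
        SmoothedPS.Expansion P X Y δ b (U θ) lamStar βStar ∧
        SmoothedPS.outcomeMean P X Y (U θ) =ᵐ[P]
          (fun ω => SmoothedPS.linPred b βStar (X 0 ω)) ∧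
        SmoothedPS.IsUnbiased P X Y δ b (U θ) lamStar βStar) := by
  refine ⟨SmoothedPS.popBeta P X Y δ b (U θ) lamStar,
    SmoothedPS.isWLSLimit_popBeta hsample hreg, fun hmodel => ?_, fun hmar hmodel => ?_,
    fun hmar hout hproj => ?_⟩
  · exact SmoothedPS.expansion_of_balanced hsample hreg (hmodel.balanced hsample hreg)
  · have hexp := SmoothedPS.expansion_of_balanced hsample hreg (hmodel.balanced hsample hreg)
    exact ⟨hexp, SmoothedPS.isUnbiased_of_integral_eq hsample hreg hexp
      (hmodel.integral_delta_smul_resid hsample hreg hmar)⟩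
  · have hexp := SmoothedPS.expansion_of_balanced hsample hreg (hproj.balanced hsample hreg)
    obtain ⟨α, hα⟩ := hout
    have hmean := SmoothedPS.integral_delta_smul_resid_of_outcomeModel hsample hreg hmar hα
    obtain rfl := SmoothedPS.eq_popBeta_of_outcomeModel hsample hreg hmar hα
    exact ⟨hexp, hα, SmoothedPS.isUnbiased_of_integral_eq hsample hreg hexp hmean⟩
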